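/- Let $(B,g_B)$ and $(F,g_F)$ be smooth Riemannian manifolds (without boundary) of dimensions $n_1$ and $n_2$, let $f:B\to(0,\infty)$ be smooth, and let $M=B\times_f F$ be the warped product, i.e. $B\times F$ with the metric $g=g_B\oplus f^2g_F$; put $\bar n=n_1+n_2$. Let $P$ be a smooth vector field on $B$; its lift to $M$, tangent to $B$, is also denoted by $P$. Conventions. On a Riemannian manifold $(N,h)$ with Levi-Civita connection $\nabla$ and a vector field $Q$, put $\pi(Y)=h(Y,Q)$ and let $\overline\nabla_XY=\nabla_XY+\pi(Y)X$ be the associated semi-symmetric non-metric connection (the case $Q=0$, in which $\overline\nabla=\nabla$, is allowed). Its curvature, Ricci tensor and scalar curvature are $$\overline R(X,Y)=\overline\nabla_X\overline\nabla_Y-\overline\nabla_Y\overline\nabla_X-\overline\nabla_{[X,Y]},\qquad \overline{Ric}(X,Y)=\sum_k h(\overline R(X,E_k)Y,E_k),\qquad \overline S=\sum_k\overline{Ric}(E_k,E_k),$$ where $(E_k)$ is an $h$-orthonormal basis of the tangent space. Let $\overline{Ric}$ and $\overline S^M$ be taken on $(M,g)$ with $Q=P$, let $\overline S^B$ be taken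 on $(B,g_B)$ with $Q=P$, and let $\overline S^F$ be taken on $(F,g_F)$ with $Q=0$ (the component of $P$ along $F$). On $B$ let $\pi(P)=g_B(P,P)$, $H^f_B(X,Y)=XYf-(\nabla^B_XY)f$, $\Delta_Bf=-\mathrm{Tr}\,H^f_B$ (the trace with respect to $g_B$), $div_BP=\sum_k g_B(\nabla^B_{E_k}P,E_k)$ over a $g_B$-orthonormal basis $(E_k)$, and $|grad_Bf|_B^2=g_B(grad_Bf,grad_Bf)$. Suppose that $M$ is quasi-Einstein with respect to $\overline\nabla$: there are real scalars $a,b$ (constants or, more generally, real functions on $M$) and a vector field $U$ on $M$ with $g(U,U)=1$ such that $$\overline{Ric}(X,Y)=a\,g(X,Y)+b\,g(X,U)\,g(Y,U)$$ for all tangent vectors $X,Y$ at each point of $M$. (Non-flatness of $M$, often part of the definition of quasi-Einstein, is not needed.) Then at every point $(x,y)$ of $M$, where functions on $B$ are evaluated at $x$ and functions on $F$ at $y$: 1) If $U$ is everywhere tangent to $B$, then $$\overline S^M=\bar n a+b,$$ $$\overline S^B=n_1a+n_2\frac{\Delta_Bf}{f}-n_2\,div_BP+n_2\,\pi(P)+b,$$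 $$\overline S^F=n_2\big[f\Delta_Bf+(1-n_2)|grad_Bf|_B^2+(1-\bar n)f\,Pf+af^2\big].$$ 2) If $U$ is everywhere tangent to $F$, then $$\overline S^M=\bar n a+b,$$ $$\overline S^B=n_1a+n_2\frac{\Delta_Bf}{f}-n_2\,div_BP+n_2\,\pi(P),$$ $$\overline S^F=n_2\big[f\Delta_Bf+(1-n_2)|grad_Bf|_B^2+(1-\bar n)f\,Pf+af^2\big]+bf^2.$$ -/

import Mathlib

open scoped Manifold ContDiff
open Bundle

noncomputable section

namespace WarpedQE

/-! ### Linear algebra: pull-back of a bilinear form, sums over an orthonormal basis -/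

/-- The pull-back `(u, v) ↦ b (A u) (A v)` of a bilinear form `b` along a linear map `A`. -/
def pullbackForm {V W : Type*} [AddCommGroup V] [Module ℝ V] [TopologicalSpace V]
    [IsTopologicalAddGroup V] [ContinuousSMul ℝ V]
    [AddCommGroup W] [Module ℝ W] [TopologicalSpace W]
    [IsTopologicalAddGroup W] [ContinuousSMul ℝ W]
    (b : W →L[ℝ] W →L[ℝ] ℝ) (A : V →L[ℝ] W) : V →L[ℝ] V →L[ℝ] ℝ :=
  ((ContinuousLinearMap.precomp ℝ A).comp b).comp A

theorem pullbackForm_apply {V W : Type*} [AddCommGroup V] [Module ℝ V] [TopologicalSpace V]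
    [IsTopologicalAddGroup V] [ContinuousSMul ℝ V]
    [AddCommGroup W] [Module ℝ W] [TopologicalSpace W]
    [IsTopologicalAddGroup W] [ContinuousSMul ℝ W]
    (b : W →L[ℝ] W →L[ℝ] ℝ) (A : V →L[ℝ] W) (u v : V) :
    pullbackForm b A u v = b (A u) (A v) := rfl

/-- The basis `e` is orthonormal for the bilinear form `b`. -/
def IsOrthonormalFor {V : Type*} [AddCommGroup V] [Module ℝ V] [TopologicalSpace V]
    (b : V →L[ℝ] V →L[ℝ] ℝ) {ι : Type*} (e : Module.Basis ι ℝ V) : Prop :=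
  (∀ i, b (e i) (e i) = 1) ∧ ∀ i j, i ≠ j → b (e i) (e j) = 0

open Classical in
/-- `∑ₖ T(eₖ, eₖ)` over an orthonormal basis `e` for the form `b` (which exists for a positive
definite form, `exists_isOrthonormalFor`; for bilinear `T` the sum does not depend on the basis,
`orthoSum_eq`). -/
def orthoSum {V : Type*} [AddCommGroup V] [Module ℝ V] [TopologicalSpace V]
    (b : V →L[ℝ] V →L[ℝ] ℝ) (T : V → V → ℝ) : ℝ :=
  if h : ∃ e : Module.Basis (Fin (Module.finrank ℝ V)) ℝ V, IsOrthonormalFor b e then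
    ∑ k, T (h.choose k) (h.choose k)
  else 0

theorem exists_isOrthonormalFor {V : Type*} [AddCommGroup V] [Module ℝ V] [TopologicalSpace V]
    [FiniteDimensional ℝ V] (b : V →L[ℝ] V →L[ℝ] ℝ) (hsymm : ∀ u v, b u v = b v u)
    (hpos : ∀ v, v ≠ 0 → 0 < b v v) :
    ∃ e : Module.Basis (Fin (Module.finrank ℝ V)) ℝ V, IsOrthonormalFor b e := by
  let c : InnerProductSpace.Core ℝ V :=
    { inner := fun u v => b u v
      conj_inner_symm := fun u v => by simp [hsymm u v]
      re_inner_nonneg := fun v => by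
        by_cases hv : v = 0
        · simp [hv]
        · simpa using (hpos v hv).le
      add_left := fun u v w => by simp
      smul_left := fun u v r => by simp
      definite := fun v hv => by
        by_contra h
        exact (hpos v h).ne' hv }
  let _ : NormedAddCommGroup V := @InnerProductSpace.Core.toNormedAddCommGroup ℝ V _ _ _ c
  let _ : InnerProductSpace ℝ V := InnerProductSpace.ofCore c.toCore
  have ho := (stdOrthonormalBasis ℝ V).orthonormal
  refine ⟨(stdOrthonormalBasis ℝ V).toBasis, fun i => ?_, fun i j hij => ?_⟩
  · have h1 : inner ℝ (stdOrthonormalBasis ℝ V i) (stdOrthonormalBasis ℝ V i) = (1 : ℝ) := by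
      rw [real_inner_self_eq_norm_sq, ho.1 i]; norm_num
    rw [OrthonormalBasis.coe_toBasis]; exact h1
  · have h2 : inner ℝ (stdOrthonormalBasis ℝ V i) (stdOrthonormalBasis ℝ V j) = (0 : ℝ) := ho.2 hij
    rw [OrthonormalBasis.coe_toBasis]; exact h2

theorem sum_eq_sum_of_isOrthonormalFor {V : Type*} [AddCommGroup V] [Module ℝ V]
    [TopologicalSpace V] (b : V →L[ℝ] V →L[ℝ] ℝ) (T : V →ₗ[ℝ] V →ₗ[ℝ] ℝ)
    {ι κ : Type*} [Fintype ι] [Fintype κ]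
    (e : Module.Basis ι ℝ V) (e' : Module.Basis κ ℝ V)
    (he : IsOrthonormalFor b e) (he' : IsOrthonormalFor b e') :
    ∑ i, T (e i) (e i) = ∑ k, T (e' k) (e' k) := by
  classical
  have hb : ∀ i j, b (e i) (e j) = if i = j then 1 else 0 := fun i j => by
    split_ifs with h
    · rw [h]; exact he.1 j
    · exact he.2 i j h
  have hb' : ∀ i j, b (e' i) (e' j) = if i = j then 1 else 0 := fun i j => by
    split_ifs with h
    · rw [h]; exact he'.1 j
    · exact he'.2 i j h
  have h1 : ∀ v, v = ∑ i, b v (e i) • e i := fun v => by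
    conv_lhs => rw [← e.sum_repr v]
    refine Finset.sum_congr rfl fun i _ => ?_
    have h : b (∑ j, e.repr v j • e j) (e i) = e.repr v i := by
      simp [-Module.Basis.sum_repr, hb]
    rw [← h, e.sum_repr]
  have h1' : ∀ v, v = ∑ i, b (e' i) v • e' i := fun v => by
    conv_lhs => rw [← e'.sum_repr v]
    refine Finset.sum_congr rfl fun i _ => ?_
    have h : b (e' i) (∑ j, e'.repr v j • e' j) = e'.repr v i := by
      simp [-Module.Basis.sum_repr, hb']
    rw [← h, e'.sum_repr]
  calc ∑ i, T (e i) (e i) = ∑ i, ∑ k, b (e' k) (e i) * T (e' k) (e i) := by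
        refine Finset.sum_congr rfl fun i _ => ?_
        conv_lhs => rw [h1' (e i)]
        conv_lhs => enter [2]; rw [← h1' (e i)]
        simp
    _ = ∑ k, ∑ i, b (e' k) (e i) * T (e' k) (e i) := Finset.sum_comm
    _ = ∑ k, T (e' k) (e' k) := by
        refine Finset.sum_congr rfl fun k _ => ?_
        conv_rhs => enter [2]; rw [h1 (e' k)]
        simp

theorem orthoSum_eq {V : Type*} [AddCommGroup V] [Module ℝ V] [TopologicalSpace V]
    [FiniteDimensional ℝ V] (b : V →L[ℝ] V →L[ℝ] ℝ) (T : V →ₗ[ℝ] V →ₗ[ℝ] ℝ)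
    {ι : Type*} [Fintype ι] (e : Module.Basis ι ℝ V) (he : IsOrthonormalFor b e) :
    orthoSum b (fun u v => T u v) = ∑ i, T (e i) (e i) := by
  have h : ∃ e : Module.Basis (Fin (Module.finrank ℝ V)) ℝ V, IsOrthonormalFor b e := by
    have hc : Fintype.card ι = Module.finrank ℝ V := (Module.finrank_eq_card_basis e).symm
    let s : ι ≃ Fin (Module.finrank ℝ V) := Fintype.equivFinOfCardEq hc
    refine ⟨e.reindex s, fun i => by simpa using he.1 (s.symm i), fun i j hij => ?_⟩
    simpa using he.2 (s.symm i) (s.symm j) (fun h => hij (s.symm.injective h))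
  rw [orthoSum, dif_pos h]
  exact sum_eq_sum_of_isOrthonormalFor b T _ e h.choose_spec he

/-! ### Connections in a coordinate domain

A metric is written `G : E → E →L[ℝ] E →L[ℝ] ℝ`; vector fields are maps `E → E`. -/

section Local

variable {E : Type*} [NormedAddCommGroup E] [NormedSpace ℝ E]

/-- Christoffel symbols `Γ(u, v)` of `G` at `z`, defined by
`2 G(Γ(u, v), w) = ∂ᵤG(v, w) + ∂ᵥG(u, w) - ∂_w G(u, v)` for all `w`. -/
def christoffel (G : E → E →L[ℝ] E →L[ℝ] ℝ) (z u v : E) : E :=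
  (G z).inverse ((1 / 2 : ℝ) •
    (fderiv ℝ G z u v + fderiv ℝ G z v u - ((fderiv ℝ G z).flip u).flip v))

/-- The Levi-Civita connection `∇_X Y = DY(X) + Γ(X, Y)` of `G`. -/
def localNabla (G : E → E →L[ℝ] E →L[ℝ] ℝ) (X Y : E → E) (z : E) : E :=
  fderiv ℝ Y z (X z) + christoffel G z (X z) (Y z)

/-- The semi-symmetric non-metric connection `∇_X Y + π(Y) X`, where `π(Y) = G(Y, P)`. -/
def localNablaBar (G : E → E →L[ℝ] E →L[ℝ] ℝ) (P : E → E) (X Y : E → E) (z : E) : E :=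
  localNabla G X Y z + G z (Y z) (P z) • X z

/-- The curvature `R(X, Y)Z = D_X D_Y Z - D_Y D_X Z - D_[X, Y] Z` of a connection `D`. -/
def localCurvature (D : (E → E) → (E → E) → E → E) (X Y Z : E → E) (z : E) : E :=
  D X (D Y Z) z - D Y (D X Z) z - D (VectorField.lieBracket ℝ X Y) Z z

/-- Nondegeneracy makes a form on a finite-dimensional space invertible. -/
theorem isInvertible_of_pos [FiniteDimensional ℝ E] (b : E →L[ℝ] E →L[ℝ] ℝ)
    (hpos : ∀ v, v ≠ 0 → 0 < b v v) : b.IsInvertible := by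
  have hinj : Function.Injective (b : E →ₗ[ℝ] E →L[ℝ] ℝ) := by
    rw [← LinearMap.ker_eq_bot, LinearMap.ker_eq_bot']
    intro v hv
    by_contra h
    have h0 : b v = 0 := hv
    have := hpos v h
    simp [h0] at this
  have hdim : Module.finrank ℝ E = Module.finrank ℝ (E →L[ℝ] ℝ) := by
    rw [← (LinearMap.toContinuousLinearMap (𝕜 := ℝ) (E := E) (F' := ℝ)).finrank_eq]
    exact (Subspace.dual_finrank_eq (K := ℝ) (V := E)).symm
  exact ⟨(LinearEquiv.ofInjectiveOfFinrankEq _ hinj hdim).toContinuousLinearEquiv,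
    by ext; rfl⟩

theorem two_mul_christoffel (G : E → E →L[ℝ] E →L[ℝ] ℝ) (z u v w : E)
    (hG : (G z).IsInvertible) :
    2 * G z (christoffel G z u v) w =
      fderiv ℝ G z u v w + fderiv ℝ G z v u w - fderiv ℝ G z w u v := by
  obtain ⟨A, hA⟩ := hG
  have : G z (christoffel G z u v) = (1 / 2 : ℝ) •
      (fderiv ℝ G z u v + fderiv ℝ G z v u - ((fderiv ℝ G z).flip u).flip v) := by
    rw [christoffel, ← hA, ContinuousLinearMap.inverse_equiv]
    simp
  rw [this]
  simp

end Local

/-! ### Riemannian geometry on a manifold, computed at each point in the preferred chart there -/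

section Manifold

variable {E : Type*} [NormedAddCommGroup E] [NormedSpace ℝ E]
  {H : Type*} [TopologicalSpace H] {I : ModelWithCorners ℝ E H}
  {M : Type*} [TopologicalSpace M] [ChartedSpace H M]

/-- The coordinate expression `ψ^* g` of the `(0,2)`-tensor field `g`, where `ψ` is the inverse of
the preferred chart at `p`. -/
def chartMetric (g : (p : M) → TangentSpace I p →L[ℝ] TangentSpace I p →L[ℝ] ℝ) (p : M) :
    E → E →L[ℝ] E →L[ℝ] ℝ := fun z =>
  pullbackForm (g ((extChartAt I p).symm z)) (mfderiv 𝓘(ℝ, E) I (extChartAt I p).symm z)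

/-- The coordinate expression of the vector field `P` in the preferred chart at `p`. -/
def chartField (P : (p : M) → TangentSpace I p) (p : M) : E → E :=
  VectorField.mpullback 𝓘(ℝ, E) I (extChartAt I p).symm P

/-- The derivative at `p` of the preferred chart at `p`. -/
def chartDeriv (I : ModelWithCorners ℝ E H) (p : M) : TangentSpace I p →L[ℝ] E :=
  mfderiv I 𝓘(ℝ, E) (extChartAt I p) p

/-- The derivative `X(f)` of the function `f` in the direction `u ∈ T_pM`. -/
def dirDeriv (f : M → ℝ) (p : M) (u : TangentSpace I p) : ℝ :=
  mfderiv I 𝓘(ℝ, ℝ) f p u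

/-- `∇_u Y` at `p`, for the Levi-Civita connection of `g`, `u ∈ T_pM` and a vector field `Y`. -/
def nabla (g : (p : M) → TangentSpace I p →L[ℝ] TangentSpace I p →L[ℝ] ℝ) (p : M)
    (u : TangentSpace I p) (Y : (p : M) → TangentSpace I p) : TangentSpace I p :=
  (chartDeriv I p).inverse
    (localNabla (chartMetric g p) (fun _ => chartDeriv I p u) (chartField Y p) (extChartAt I p p))

/-- The curvature tensor `(u, v, w) ↦ R(u, v)w` on `T_pM` of the semi-symmetric non-metric
connection determined by the metric `g` and the vector field `P`. The tangent vectors are extended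
by vector fields with constant coordinates. For `P = 0` this is the Riemann curvature tensor. -/
def curvatureBar (g : (p : M) → TangentSpace I p →L[ℝ] TangentSpace I p →L[ℝ] ℝ)
    (P : (p : M) → TangentSpace I p) (p : M) (u v w : TangentSpace I p) : TangentSpace I p :=
  (chartDeriv I p).inverse
    (localCurvature (localNablaBar (chartMetric g p) (chartField P p))
      (fun _ => chartDeriv I p u) (fun _ => chartDeriv I p v) (fun _ => chartDeriv I p w)
      (extChartAt I p p))

/-- The Ricci tensor `∑ₖ g(R(u, eₖ)v, eₖ)` of the semi-symmetric non-metric connection. -/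
def ricciBar (g : (p : M) → TangentSpace I p →L[ℝ] TangentSpace I p →L[ℝ] ℝ)
    (P : (p : M) → TangentSpace I p) (p : M) (u v : TangentSpace I p) : ℝ :=
  orthoSum (g p) (fun e e' => g p (curvatureBar g P p u e v) e')

/-- The scalar curvature `∑ₖ Ric(eₖ, eₖ)` of the semi-symmetric non-metric connection. -/
def scalarBar (g : (p : M) → TangentSpace I p →L[ℝ] TangentSpace I p →L[ℝ] ℝ)
    (P : (p : M) → TangentSpace I p) (p : M) : ℝ :=
  orthoSum (g p) (ricciBar g P p)

/-- The Hessian `H^f(X, Y) = X(Y f) - (∇_X Y) f` at `p`, with `X`, `Y` the extensions of `u`, `v`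
by vector fields with constant coordinates. -/
def hessian (g : (p : M) → TangentSpace I p →L[ℝ] TangentSpace I p →L[ℝ] ℝ)
    (f : M → ℝ) (p : M) (u v : TangentSpace I p) : ℝ :=
  fderiv ℝ (fun z => fderiv ℝ (f ∘ (extChartAt I p).symm) z (chartDeriv I p v))
      (extChartAt I p p) (chartDeriv I p u) -
    fderiv ℝ (f ∘ (extChartAt I p).symm) (extChartAt I p p)
      (localNabla (chartMetric g p) (fun _ => chartDeriv I p u) (fun _ => chartDeriv I p v)
        (extChartAt I p p))

/-- The Laplacian, with the sign convention `Δ f = -Tr H^f`. -/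
def laplacian (g : (p : M) → TangentSpace I p →L[ℝ] TangentSpace I p →L[ℝ] ℝ)
    (f : M → ℝ) (p : M) : ℝ :=
  -orthoSum (g p) (hessian g f p)

/-- The divergence `∑ₖ g(∇_{eₖ} P, eₖ)`. -/
def divergence (g : (p : M) → TangentSpace I p →L[ℝ] TangentSpace I p →L[ℝ] ℝ)
    (P : (p : M) → TangentSpace I p) (p : M) : ℝ :=
  orthoSum (g p) (fun e e' => g p (nabla g p e P) e')

/-- The gradient: `g(grad f, u) = u(f)`. -/
def gradVec (g : (p : M) → TangentSpace I p →L[ℝ] TangentSpace I p →L[ℝ] ℝ)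
    (f : M → ℝ) (p : M) : TangentSpace I p :=
  (g p).inverse (mfderiv I 𝓘(ℝ, ℝ) f p)

/-- The Ricci tensor of the semi-symmetric non-metric connection given by `g` and `P` has the form
`a g + b A ⊗ A`, with `A(X) = g(X, U)` and `U` a `g`-unit vector field. -/
structure IsQuasiEinstein (g : (p : M) → TangentSpace I p →L[ℝ] TangentSpace I p →L[ℝ] ℝ)
    (P : (p : M) → TangentSpace I p) (a b : M → ℝ) (U : (p : M) → TangentSpace I p) : Prop where
  unit : ∀ p, g p (U p) (U p) = 1
  ricci_eq : ∀ p (u v : TangentSpace I p),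
    ricciBar g P p u v = a p * g p u v + b p * (g p u (U p) * g p v (U p))

end Manifold

/-! ### Warped products -/

section Warped

variable {E₁ : Type*} [NormedAddCommGroup E₁] [NormedSpace ℝ E₁]
  {H₁ : Type*} [TopologicalSpace H₁] {I₁ : ModelWithCorners ℝ E₁ H₁}
  {B : Type*} [TopologicalSpace B] [ChartedSpace H₁ B]
  {E₂ : Type*} [NormedAddCommGroup E₂] [NormedSpace ℝ E₂]
  {H₂ : Type*} [TopologicalSpace H₂] {I₂ : ModelWithCorners ℝ E₂ H₂}
  {F : Type*} [TopologicalSpace F] [ChartedSpace H₂ F]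

/-- The warped product metric `g_B ⊕ f² g_F` on `B × F`. -/
def warpedMetric (gB : (x : B) → TangentSpace I₁ x →L[ℝ] TangentSpace I₁ x →L[ℝ] ℝ)
    (gF : (y : F) → TangentSpace I₂ y →L[ℝ] TangentSpace I₂ y →L[ℝ] ℝ) (f : B → ℝ)
    (p : B × F) :
    TangentSpace (I₁.prod I₂) p →L[ℝ] TangentSpace (I₁.prod I₂) p →L[ℝ] ℝ :=
  pullbackForm (gB p.1) (mfderiv (I₁.prod I₂) I₁ Prod.fst p) +
    (f p.1 ^ 2) • pullbackForm (gF p.2) (mfderiv (I₁.prod I₂) I₂ Prod.snd p)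

/-- The lift to `B × F` of a vector field `P` on the base. -/
def liftFromBase (I₂ : ModelWithCorners ℝ E₂ H₂) (P : (x : B) → TangentSpace I₁ x) (p : B × F) :
    TangentSpace (I₁.prod I₂) p :=
  mfderiv I₁ (I₁.prod I₂) (fun x => (x, p.2)) p.1 (P p.1)

/-- The vector field `U` on `B × F` is tangent to the base factor. -/
def TangentToBase (U : (p : B × F) → TangentSpace (I₁.prod I₂) p) : Prop :=
  ∀ p, mfderiv (I₁.prod I₂) I₂ Prod.snd p (U p) = 0

/-- The vector field `U` on `B × F` is tangent to the fibre factor. -/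
def TangentToFibre (U : (p : B × F) → TangentSpace (I₁.prod I₂) p) : Prop :=
  ∀ p, mfderiv (I₁.prod I₂) I₁ Prod.fst p (U p) = 0

end Warped

end WarpedQE

end

open WarpedQE

/-! All four quantities are traces, so the proof computes the Ricci tensor of the connection and
traces it over one factor at a time.

Write π = g(·, Q) and n for the dimension. Metric compatibility and symmetry of the Levi-Civita
connection give R̄(u,v)w = R(u,v)w + g(w, ∇_u Q) v - g(w, ∇_v Q) u + π(w)(π(v) u - π(u) v). With
this sign convention Ric(u,v) is the trace of e ↦ R(u,e)v, the negative of the usual Ricci tensor.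
Hence Ric̄(u,v) = Ric(u,v) + (n - 1)(g(v, ∇_u Q) - π(u)π(v)), and the scalar curvature gains (n -
1)(div Q - π(Q)) (`IsMetricNear.localCurvature_eq`, `IsMetricNear.localRicciBar_eq`,
`IsMetricNear.orthoSum_localRicciBar`).

For the warped product, the Christoffel symbols come from the Koszul identity. They give Ric = Ric_B
+ n₂ H^f / f on base vectors and Ric = Ric_F + (f Tr H^f + (n₂ - 1)|grad f|²) g_F on fibre vectors
(`localRicci_localWarped_base`, `localRicci_localWarped_fibre`). For vertical V, ∇_V P = (Pf / f) V
(`localNablaL_localWarped`).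

The quasi-Einstein identity is evaluated on pairs (eᵢ, eᵢ), with (eᵢ) orthonormal in one factor, and
summed; mixed components never enter. Over B the correction has coefficient n̄ - 1 on M but n₁ - 1
on B, and the difference n₂ multiplies div P - π(P). The b-term contributes b g_B(U_B, U_B) over B
and b f⁴ g_F(U_F, U_F) over F, where U_B, U_F are the components of U. If U is tangent to one
factor, one component vanishes and g(U,U) = 1 fixes the other.

The calculation is done in coordinates. At p the preferred chart has identity derivative, so
coordinate formulas at its image are formulas on T_pM. -/

namespace WarpedQE

open Filter Topology

set_option maxSynthPendingDepth 3
set_option synthInstance.maxHeartbeats 200000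

noncomputable section

/-! ### Traces -/

section Trace

variable {V : Type*} [AddCommGroup V] [Module ℝ V] [TopologicalSpace V]

/-- Expansion of a vector in an orthonormal basis. -/
theorem sum_form_smul_of_isOrthonormalFor (b : V →L[ℝ] V →L[ℝ] ℝ)
    {ι : Type*} [Fintype ι] (e : Module.Basis ι ℝ V) (he : IsOrthonormalFor b e) (v : V) :
    ∑ i, b v (e i) • e i = v := by
  classical
  have hb : ∀ i j, b (e i) (e j) = if i = j then 1 else 0 := fun i j => by
    split_ifs with h
    · rw [h]; exact he.1 j
    · exact he.2 i j h
  conv_rhs => rw [← e.sum_repr v]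
  refine Finset.sum_congr rfl fun i _ => ?_
  have h : b (∑ j, e.repr v j • e j) (e i) = e.repr v i := by
    simp [-Module.Basis.sum_repr, hb]
  rw [← h, e.sum_repr]

theorem repr_eq_of_isOrthonormalFor (b : V →L[ℝ] V →L[ℝ] ℝ)
    {ι : Type*} [Fintype ι] (e : Module.Basis ι ℝ V) (he : IsOrthonormalFor b e) (v : V) (i : ι) :
    e.repr v i = b v (e i) := by
  classical
  conv_lhs => rw [← sum_form_smul_of_isOrthonormalFor b e he v]
  rw [e.repr_sum_self]

/-- Parseval's identity for a form and an orthonormal basis. -/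
theorem sum_form_mul_of_isOrthonormalFor (b : V →L[ℝ] V →L[ℝ] ℝ)
    {ι : Type*} [Fintype ι] (e : Module.Basis ι ℝ V) (he : IsOrthonormalFor b e) (v w : V) :
    ∑ i, b v (e i) * b (e i) w = b v w := by
  conv_rhs => rw [← sum_form_smul_of_isOrthonormalFor b e he v]
  simp

/-- In an orthonormal basis the diagonal matrix entries of A are b(A eᵢ, eᵢ). Passing to the trace
makes basis independence automatic. -/
theorem sum_form_eq_trace (b : V →L[ℝ] V →L[ℝ] ℝ)
    {ι : Type*} [Fintype ι] (e : Module.Basis ι ℝ V) (he : IsOrthonormalFor b e)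
    (A : V →ₗ[ℝ] V) :
    ∑ i, b (A (e i)) (e i) = LinearMap.trace ℝ V A := by
  classical
  rw [LinearMap.trace_eq_matrix_trace ℝ e, Matrix.trace]
  refine Finset.sum_congr rfl fun i _ => ?_
  rw [Matrix.diag_apply, LinearMap.toMatrix_apply, repr_eq_of_isOrthonormalFor b e he]

theorem orthoSum_eq_trace [FiniteDimensional ℝ V] (b : V →L[ℝ] V →L[ℝ] ℝ)
    (h : ∃ e : Module.Basis (Fin (Module.finrank ℝ V)) ℝ V, IsOrthonormalFor b e)
    (A : V →ₗ[ℝ] V) :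
    orthoSum b (fun e e' => b (A e) e') = LinearMap.trace ℝ V A := by
  rw [orthoSum, dif_pos h]
  exact sum_form_eq_trace b _ h.choose_spec A

end Trace

/-- Split A through the two projections and use tr(XY) = tr(YX): only the diagonal blocks
contribute. -/
theorem trace_prod {V W : Type*} [AddCommGroup V] [Module ℝ V] [AddCommGroup W] [Module ℝ W]
    [FiniteDimensional ℝ V] [FiniteDimensional ℝ W] (A : V × W →ₗ[ℝ] V × W) :
    LinearMap.trace ℝ (V × W) A =
      LinearMap.trace ℝ V (LinearMap.fst ℝ V W ∘ₗ A ∘ₗ LinearMap.inl ℝ V W) +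
      LinearMap.trace ℝ W (LinearMap.snd ℝ V W ∘ₗ A ∘ₗ LinearMap.inr ℝ V W) := by
  have hA : A = (A ∘ₗ LinearMap.inl ℝ V W) ∘ₗ LinearMap.fst ℝ V W +
      (A ∘ₗ LinearMap.inr ℝ V W) ∘ₗ LinearMap.snd ℝ V W := by
    refine LinearMap.ext fun v => ?_
    simp only [LinearMap.add_apply, LinearMap.comp_apply, LinearMap.fst_apply, LinearMap.snd_apply,
      LinearMap.inl_apply, LinearMap.inr_apply]
    rw [← map_add]; simp
  conv_lhs => rw [hA]
  rw [map_add, LinearMap.trace_comp_comm' (LinearMap.fst ℝ V W),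
    LinearMap.trace_comp_comm' (LinearMap.snd ℝ V W)]

/-! ### Metrics in a coordinate domain -/

section Local

variable {E : Type*} [NormedAddCommGroup E] [NormedSpace ℝ E]

/-- `G` is a Riemannian metric of class `C²` in a neighbourhood of `z₀`. -/
structure IsMetricNear (G : E → E →L[ℝ] E →L[ℝ] ℝ) (z₀ : E) : Prop where
  contDiffAt : ContDiffAt ℝ 2 G z₀
  symm : ∀ᶠ z in 𝓝 z₀, ∀ u v, G z u v = G z v u
  pos : ∀ᶠ z in 𝓝 z₀, ∀ v, v ≠ 0 → 0 < G z v v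

/-- The Christoffel symbols as a bilinear map. -/
def christoffelL (G : E → E →L[ℝ] E →L[ℝ] ℝ) (z : E) : E →L[ℝ] E →L[ℝ] E :=
  (ContinuousLinearMap.compL ℝ E (E →L[ℝ] ℝ) E (G z).inverse).comp
    ((1 / 2 : ℝ) • (fderiv ℝ G z + (fderiv ℝ G z).flip -
      ((ContinuousLinearMap.flipₗᵢ ℝ E E ℝ).toContinuousLinearEquiv :
        (E →L[ℝ] E →L[ℝ] ℝ) →L[ℝ] E →L[ℝ] E →L[ℝ] ℝ).comp (fderiv ℝ G z).flip))

theorem christoffelL_apply (G : E → E →L[ℝ] E →L[ℝ] ℝ) (z u v : E) :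
    christoffelL G z u v = christoffel G z u v := by
  rw [christoffelL, christoffel]
  simp only [ContinuousLinearMap.comp_apply, ContinuousLinearMap.compL_apply]
  congr 1

/-- The Riemann curvature tensor in coordinates. -/
def localRiem (G : E → E →L[ℝ] E →L[ℝ] ℝ) (z u v w : E) : E :=
  fderiv ℝ (christoffelL G) z u v w - fderiv ℝ (christoffelL G) z v u w +
    christoffel G z u (christoffel G z v w) - christoffel G z v (christoffel G z u w)

/-- The endomorphism `e ↦ R(u, e) w`. -/
def localRiemL (G : E → E →L[ℝ] E →L[ℝ] ℝ) (z u w : E) : E →ₗ[ℝ] E where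
  toFun e := localRiem G z u e w
  map_add' x y := by
    simp only [localRiem, ← christoffelL_apply, map_add, add_apply]; abel
  map_smul' c x := by
    simp only [localRiem, ← christoffelL_apply, map_smul, smul_apply,
      RingHom.id_apply, smul_sub, smul_add]

/-- The Ricci tensor in coordinates, as the trace of `e ↦ R(u, e) v`. -/
def localRicci (G : E → E →L[ℝ] E →L[ℝ] ℝ) (z u v : E) : ℝ :=
  LinearMap.trace ℝ E (localRiemL G z u v)

/-- The Ricci tensor in coordinates as a bilinear form. -/
def localRicciL (G : E → E →L[ℝ] E →L[ℝ] ℝ) (z : E) : E →ₗ[ℝ] E →ₗ[ℝ] ℝ :=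
  LinearMap.mk₂ ℝ (localRicci G z)
    (fun u u' v => by
      simp only [localRicci]; rw [← map_add]; congr 1; ext e
      change localRiem G z (u + u') e v = localRiem G z u e v + localRiem G z u' e v
      simp only [localRiem, ← christoffelL_apply, map_add, add_apply]; abel)
    (fun c u v => by
      simp only [localRicci]; rw [← map_smul]; congr 1; ext e
      change localRiem G z (c • u) e v = c • localRiem G z u e v
      simp only [localRiem, ← christoffelL_apply, map_smul, smul_apply, smul_sub, smul_add])
    (fun u v v' => by
      simp only [localRicci]; rw [← map_add]; congr 1; ext e
      change localRiem G z u e (v + v') = localRiem G z u e v + localRiem G z u e v'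
      simp only [localRiem, ← christoffelL_apply, map_add]; abel)
    (fun c u v => by
      simp only [localRicci]; rw [← map_smul]; congr 1; ext e
      change localRiem G z u e (c • v) = c • localRiem G z u e v
      simp only [localRiem, ← christoffelL_apply, map_smul, smul_sub, smul_add])

theorem IsMetricNear.differentiableAt {G : E → E →L[ℝ] E →L[ℝ] ℝ} {z₀ : E}
    (hG : IsMetricNear G z₀) : DifferentiableAt ℝ G z₀ :=
  hG.contDiffAt.differentiableAt (by norm_num)

/-- Differentiates the symmetry of G, which is why symmetry is needed in a neighbourhood and not
only at the point. -/
theorem fderiv_metric_symm {G : E → E →L[ℝ] E →L[ℝ] ℝ} {z₀ : E} (hG : DifferentiableAt ℝ G z₀)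
    (hs : ∀ᶠ z in 𝓝 z₀, ∀ u v, G z u v = G z v u) (x u v : E) :
    fderiv ℝ G z₀ x u v = fderiv ℝ G z₀ x v u := by
  have key : ∀ u v, HasFDerivAt (fun z => G z u v) (((fderiv ℝ G z₀).flip u).flip v) z₀ := by
    intro u v
    refine ((hG.hasFDerivAt.clm_apply (hasFDerivAt_const u z₀)).clm_apply
      (hasFDerivAt_const v z₀)).congr_fderiv ?_
    ext; simp
  have h := (key u v).unique ((key v u).congr_of_eventuallyEq (hs.mono fun z hz => hz u v))
  simpa using congrArg (fun L => L x) h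

theorem localNabla_const (G : E → E →L[ℝ] E →L[ℝ] ℝ) (u v z : E) :
    localNabla G (fun _ => u) (fun _ => v) z = christoffel G z u v := by
  simp [localNabla]

variable [FiniteDimensional ℝ E]

theorem IsMetricNear.exists_isOrthonormalFor {G : E → E →L[ℝ] E →L[ℝ] ℝ} {z₀ : E}
    (hG : IsMetricNear G z₀) :
    ∃ e : Module.Basis (Fin (Module.finrank ℝ E)) ℝ E, IsOrthonormalFor (G z₀) e :=
  WarpedQE.exists_isOrthonormalFor (G z₀) hG.symm.self_of_nhds hG.pos.self_of_nhds

theorem ContDiffAt.clm_inverse {X : Type*} [NormedAddCommGroup X] [NormedSpace ℝ X]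
    {G : X → E →L[ℝ] E →L[ℝ] ℝ} {x : X} {n : WithTop ℕ∞} (hG : ContDiffAt ℝ n G x)
    (h : (G x).IsInvertible) : ContDiffAt ℝ n (fun y => (G y).inverse) x := by
  have : CompleteSpace E := FiniteDimensional.complete ℝ E
  exact h.contDiffAt_map_inverse.comp x hG

/-- The symbols involve one derivative of a C² metric and its inverse, hence are C¹; this is what
curvature requires. -/
theorem IsMetricNear.contDiffAt_christoffelL {G : E → E →L[ℝ] E →L[ℝ] ℝ} {z₀ : E}
    (hG : IsMetricNear G z₀) : ContDiffAt ℝ 1 (christoffelL G) z₀ := by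
  have h1 : ContDiffAt ℝ 1 (fun z => (G z).inverse) z₀ :=
    ContDiffAt.clm_inverse (hG.contDiffAt.of_le (by norm_num))
      (isInvertible_of_pos _ hG.pos.self_of_nhds)
  have h2 : ContDiffAt ℝ 1 (fderiv ℝ G) z₀ := hG.contDiffAt.fderiv_right (by norm_num)
  have h3 : ContDiffAt ℝ 1 (fun z => (fderiv ℝ G z).flip) z₀ :=
    (ContinuousLinearMap.flipₗᵢ ℝ E E (E →L[ℝ] ℝ)).toContinuousLinearEquiv.contDiff.contDiffAt.comp
      z₀ h2
  have h4 : ContDiffAt ℝ 1 (fun z =>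
      ContinuousLinearMap.compL ℝ E (E →L[ℝ] ℝ) E (G z).inverse) z₀ :=
    (ContinuousLinearMap.compL ℝ E (E →L[ℝ] ℝ) E).contDiff.contDiffAt.comp z₀ h1
  have h5 : ContDiffAt ℝ 1 (fun z => (1 / 2 : ℝ) • (fderiv ℝ G z + (fderiv ℝ G z).flip -
      ((ContinuousLinearMap.flipₗᵢ ℝ E E ℝ).toContinuousLinearEquiv :
        (E →L[ℝ] E →L[ℝ] ℝ) →L[ℝ] E →L[ℝ] E →L[ℝ] ℝ).comp (fderiv ℝ G z).flip)) z₀ :=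
    ((h2.add h3).sub (contDiffAt_const.clm_comp h3)).const_smul _
  exact h4.clm_comp h5

theorem IsMetricNear.differentiableAt_christoffelL {G : E → E →L[ℝ] E →L[ℝ] ℝ} {z₀ : E}
    (hG : IsMetricNear G z₀) : DifferentiableAt ℝ (christoffelL G) z₀ :=
  hG.contDiffAt_christoffelL.differentiableAt (by norm_num)

theorem IsMetricNear.hasFDerivAt_christoffel {G : E → E →L[ℝ] E →L[ℝ] ℝ} {z₀ : E}
    (hG : IsMetricNear G z₀) (v w : E) :
    HasFDerivAt (fun z => christoffel G z v w)
      (((fderiv ℝ (christoffelL G) z₀).flip v).flip w) z₀ := by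
  simp_rw [← christoffelL_apply]
  have h := ((hG.differentiableAt_christoffelL.hasFDerivAt.clm_apply
    (hasFDerivAt_const v z₀)).clm_apply (hasFDerivAt_const w z₀))
  refine h.congr_fderiv ?_
  ext; simp

/-- The Koszul identity determines its solution: testing the difference of two solutions against
itself contradicts positivity unless it is zero. A guessed formula for the symbols therefore only
has to be verified. -/
theorem christoffel_eq_of_forall {G : E → E →L[ℝ] E →L[ℝ] ℝ} {z u v c : E}
    (hpos : ∀ v, v ≠ 0 → 0 < G z v v)
    (h : ∀ w, 2 * G z c w = fderiv ℝ G z u v w + fderiv ℝ G z v u w - fderiv ℝ G z w u v) :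
    christoffel G z u v = c := by
  by_contra hne
  have h1 : G z (christoffel G z u v - c) (christoffel G z u v - c) = 0 := by
    have h2 := two_mul_christoffel G z u v (christoffel G z u v - c) (isInvertible_of_pos _ hpos)
    have h3 := h (christoffel G z u v - c)
    rw [map_sub (G z), sub_apply]
    linarith
  exact (hpos _ (sub_ne_zero.2 hne)).ne' h1

/-- The Levi-Civita connection is metric. -/
theorem IsMetricNear.fderiv_eq {G : E → E →L[ℝ] E →L[ℝ] ℝ} {z₀ : E}
    (hG : IsMetricNear G z₀) (x u v : E) :
    fderiv ℝ G z₀ x u v = G z₀ (christoffel G z₀ x u) v + G z₀ u (christoffel G z₀ x v) := by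
  have hi := isInvertible_of_pos _ hG.pos.self_of_nhds
  have h1 := two_mul_christoffel G z₀ x u v hi
  have h2 := two_mul_christoffel G z₀ x v u hi
  have h := fderiv_metric_symm hG.differentiableAt hG.symm
  -- Adding the Koszul identities for (x, u) and (x, v) cancels all derivatives except the one along
  -- x.
  rw [hG.symm.self_of_nhds u]
  linarith [h x u v, h u x v, h v x u]

theorem IsMetricNear.christoffel_comm {G : E → E →L[ℝ] E →L[ℝ] ℝ} {z₀ : E}
    (hG : IsMetricNear G z₀) (u v : E) : christoffel G z₀ u v = christoffel G z₀ v u := by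
  refine christoffel_eq_of_forall hG.pos.self_of_nhds fun w => ?_
  rw [two_mul_christoffel G z₀ v u w (isInvertible_of_pos _ hG.pos.self_of_nhds),
    fderiv_metric_symm hG.differentiableAt hG.symm w u v]
  ring

/-! ### The curvature of the semi-symmetric non-metric connection -/

/-- The fields are constant, so the bracket term drops out and the two iterated derivatives can be
expanded directly. -/
theorem IsMetricNear.localCurvature_eq {G : E → E →L[ℝ] E →L[ℝ] ℝ} {z₀ : E} {Q : E → E}
    (hG : IsMetricNear G z₀) (hQ : DifferentiableAt ℝ Q z₀) (u v w : E) :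
    localCurvature (localNablaBar G Q) (fun _ => u) (fun _ => v) (fun _ => w) z₀ =
      localRiem G z₀ u v w + G z₀ w (localNabla G (fun _ => u) Q z₀) • v
        - G z₀ w (localNabla G (fun _ => v) Q z₀) • u
        + G z₀ w (Q z₀) • (G z₀ v (Q z₀) • u - G z₀ u (Q z₀) • v) := by
  have hbar : ∀ v : E, localNablaBar G Q (fun _ => v) (fun _ => w) =
      fun z => christoffel G z v w + G z w (Q z) • v := by
    intro v; ext z; simp [localNablaBar, localNabla_const]
  have hpi : HasFDerivAt (fun z => G z w (Q z))
      ((G z₀ w).comp (fderiv ℝ Q z₀) + ((fderiv ℝ G z₀).flip w).flip (Q z₀)) z₀ := by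
    refine ((hG.differentiableAt.hasFDerivAt.clm_apply (hasFDerivAt_const w z₀)).clm_apply
      hQ.hasFDerivAt).congr_fderiv ?_
    ext; simp
  have hD : ∀ u v : E, localNablaBar G Q (fun _ => u)
        (localNablaBar G Q (fun _ => v) (fun _ => w)) z₀ =
      fderiv ℝ (christoffelL G) z₀ u v w
        + (G z₀ w (fderiv ℝ Q z₀ u) + fderiv ℝ G z₀ u w (Q z₀)) • v
        + christoffel G z₀ u (christoffel G z₀ v w) + G z₀ w (Q z₀) • christoffel G z₀ u v
        + (G z₀ (christoffel G z₀ v w) (Q z₀) + G z₀ w (Q z₀) * G z₀ v (Q z₀)) • u := by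
    intro u v
    rw [hbar v]
    have h : HasFDerivAt (fun z => christoffel G z v w + G z w (Q z) • v) _ z₀ :=
      (hG.hasFDerivAt_christoffel v w).add (hpi.smul_const v)
    rw [localNablaBar, localNabla, HasFDerivAt.fderiv h]
    simp only [← christoffelL_apply]
    simp [add_assoc]
  have hzero : localNablaBar G Q (VectorField.lieBracket ℝ (fun _ => u) (fun _ => v))
      (fun _ => w) z₀ = 0 := by
    simp [localNablaBar, localNabla, VectorField.lieBracket, ← christoffelL_apply]
  -- Metric compatibility expands ∂ᵤG(w, Q) as G(Γ(u,w), Q) + G(w, Γ(u,Q)). The first summand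
  -- cancels against the other iterated derivative, the second completes ∇_u Q, and the terms
  -- π(w)Γ(u,v) cancel by symmetry of Γ.
  rw [localCurvature, hzero, hD, hD, hG.fderiv_eq, hG.fderiv_eq, hG.christoffel_comm v u]
  simp only [localRiem, localNabla, map_add]
  module

end Local

/-! ### Gradient, Hessian and traced curvature in coordinates -/

section Local

variable {E : Type*} [NormedAddCommGroup E] [NormedSpace ℝ E]

/-- The endomorphism `u ↦ ∇_u Q`. -/
def localNablaL (G : E → E →L[ℝ] E →L[ℝ] ℝ) (Q : E → E) (z : E) : E →ₗ[ℝ] E :=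
  ((fderiv ℝ Q z + (christoffelL G z).flip (Q z) : E →L[ℝ] E) : E →ₗ[ℝ] E)

theorem localNablaL_apply (G : E → E →L[ℝ] E →L[ℝ] ℝ) (Q : E → E) (z u : E) :
    localNablaL G Q z u = localNabla G (fun _ => u) Q z := by
  simp [localNablaL, localNabla, christoffelL_apply]

/-- The gradient in coordinates. -/
def localGrad (G : E → E →L[ℝ] E →L[ℝ] ℝ) (φ : E → ℝ) (z : E) : E :=
  (G z).inverse (fderiv ℝ φ z)

/-- The Hessian in coordinates. -/
def localHess (G : E → E →L[ℝ] E →L[ℝ] ℝ) (φ : E → ℝ) (z u v : E) : ℝ :=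
  fderiv ℝ (fun z => fderiv ℝ φ z v) z u - fderiv ℝ φ z (christoffel G z u v)

theorem IsMetricNear.eventually {G : E → E →L[ℝ] E →L[ℝ] ℝ} {z₀ : E}
    (hG : IsMetricNear G z₀) : ∀ᶠ z in 𝓝 z₀, IsMetricNear G z := by
  filter_upwards [hG.contDiffAt.eventually (by simp), eventually_eventually_nhds.2 hG.symm,
    eventually_eventually_nhds.2 hG.pos] with z h1 h2 h3
  exact ⟨h1, h2, h3⟩

variable [FiniteDimensional ℝ E] {G : E → E →L[ℝ] E →L[ℝ] ℝ} {z₀ : E}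

theorem IsMetricNear.apply_localGrad (hG : IsMetricNear G z₀) (φ : E → ℝ) (v : E) :
    G z₀ (localGrad G φ z₀) v = fderiv ℝ φ z₀ v := by
  obtain ⟨A, hA⟩ := isInvertible_of_pos _ hG.pos.self_of_nhds
  rw [localGrad, ← hA, ContinuousLinearMap.inverse_equiv]
  simp

theorem IsMetricNear.contDiffAt_localGrad (hG : IsMetricNear G z₀) {φ : E → ℝ}
    (hφ : ContDiffAt ℝ 2 φ z₀) : ContDiffAt ℝ 1 (localGrad G φ) z₀ :=
  (ContDiffAt.clm_inverse (hG.contDiffAt.of_le (by norm_num))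
    (isInvertible_of_pos _ hG.pos.self_of_nhds)).clm_apply (hφ.fderiv_right (by norm_num))

/-- Differentiate G(grad φ, v) = dφ(v), valid near the point, and apply metric compatibility. -/
theorem IsMetricNear.apply_localNablaL_localGrad (hG : IsMetricNear G z₀) {φ : E → ℝ}
    (hφ : ContDiffAt ℝ 2 φ z₀) (u v : E) :
    G z₀ (localNablaL G (localGrad G φ) z₀ u) v = localHess G φ z₀ u v := by
  have hN := (hG.contDiffAt_localGrad hφ).differentiableAt (by norm_num)
  have h1 : HasFDerivAt (fun z => G z (localGrad G φ z) v)
      (((fderiv ℝ G z₀).flip (localGrad G φ z₀)).flip v +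
        ((G z₀).flip v).comp (fderiv ℝ (localGrad G φ) z₀)) z₀ := by
    refine ((hG.differentiableAt.hasFDerivAt.clm_apply hN.hasFDerivAt).clm_apply
      (hasFDerivAt_const v z₀)).congr_fderiv ?_
    ext; simp [add_comm]
  have h2 : (fun z => fderiv ℝ φ z v) =ᶠ[𝓝 z₀] fun z => G z (localGrad G φ z) v :=
    hG.eventually.mono fun z hz => (hz.apply_localGrad φ v).symm
  rw [localHess, h2.fderiv_eq, h1.fderiv, ← hG.apply_localGrad φ]
  simp only [add_apply, ContinuousLinearMap.flip_apply, ContinuousLinearMap.comp_apply,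
    localNablaL_apply, localNabla, map_add, hG.fderiv_eq]
  ring

theorem IsMetricNear.orthoSum_localHess (hG : IsMetricNear G z₀) {φ : E → ℝ}
    (hφ : ContDiffAt ℝ 2 φ z₀) :
    orthoSum (G z₀) (localHess G φ z₀) =
      LinearMap.trace ℝ E (localNablaL G (localGrad G φ) z₀) := by
  rw [← orthoSum_eq_trace (G z₀) hG.exists_isOrthonormalFor]
  congr 1
  ext u v
  exact (hG.apply_localNablaL_localGrad hφ u v).symm

/-- The Ricci tensor of the semi-symmetric non-metric connection in terms of the Riemannian one. -/
theorem IsMetricNear.localRicciBar_eq (hG : IsMetricNear G z₀) {Q : E → E}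
    (hQ : DifferentiableAt ℝ Q z₀) (u v : E) :
    orthoSum (G z₀) (fun e e' => G z₀ (localCurvature (localNablaBar G Q) (fun _ => u)
      (fun _ => e) (fun _ => v) z₀) e') =
    localRicci G z₀ u v + ((Module.finrank ℝ E : ℝ) - 1) *
      (G z₀ v (localNablaL G Q z₀ u) - G z₀ u (Q z₀) * G z₀ v (Q z₀)) := by
  -- The curvature as an endomorphism in its second argument: the multiples of the identity have
  -- trace proportional to dim E, and the rank-one terms trace to evaluations. Together they produce
  -- the factor dim E - 1.
  let A : E →ₗ[ℝ] E := localRiemL G z₀ u v + G z₀ v (localNablaL G Q z₀ u) • LinearMap.id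
    - ((G z₀ v : E →ₗ[ℝ] ℝ) ∘ₗ localNablaL G Q z₀).smulRight u
    + G z₀ v (Q z₀) • (((G z₀).flip (Q z₀) : E →ₗ[ℝ] ℝ).smulRight u -
      G z₀ u (Q z₀) • LinearMap.id)
  have hA : ∀ e, localCurvature (localNablaBar G Q) (fun _ => u) (fun _ => e) (fun _ => v) z₀ =
      A e := fun e => by
    rw [hG.localCurvature_eq hQ, ← localNablaL_apply, ← localNablaL_apply]
    rfl
  simp_rw [hA]
  rw [orthoSum_eq_trace (G z₀) hG.exists_isOrthonormalFor]
  simp only [A, map_add, map_sub, map_smul, LinearMap.trace_smulRight, LinearMap.trace_id,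
    smul_eq_mul, localRicci]
  simp
  ring

/-- The scalar curvature of the semi-symmetric non-metric connection. -/
theorem IsMetricNear.orthoSum_localRicciBar (hG : IsMetricNear G z₀) (Q : E → E) (c : ℝ)
    {ι : Type*} [Fintype ι] (e : Module.Basis ι ℝ E) (he : IsOrthonormalFor (G z₀) e) :
    orthoSum (G z₀) (fun u v => localRicci G z₀ u v + c *
      (G z₀ v (localNablaL G Q z₀ u) - G z₀ u (Q z₀) * G z₀ v (Q z₀))) =
    ∑ i, localRicci G z₀ (e i) (e i) +
      c * (LinearMap.trace ℝ E (localNablaL G Q z₀) - G z₀ (Q z₀) (Q z₀)) := by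
  let g : E →ₗ[ℝ] E →ₗ[ℝ] ℝ := ContinuousLinearMap.toLinearMap₁₂ (G z₀)
  let q : E →ₗ[ℝ] ℝ := ((G z₀).flip (Q z₀) : E →ₗ[ℝ] ℝ)
  -- Bilinearity allows the sum to be taken in the given basis e rather than the one chosen inside
  -- `orthoSum`.
  let T : E →ₗ[ℝ] E →ₗ[ℝ] ℝ := localRicciL G z₀ + c •
    (g ∘ₗ localNablaL G Q z₀ - q.smulRight q)
  have hT : ∀ u v, localRicci G z₀ u v + c *
      (G z₀ v (localNablaL G Q z₀ u) - G z₀ u (Q z₀) * G z₀ v (Q z₀)) = T u v := fun u v => by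
    rw [hG.symm.self_of_nhds v]
    rfl
  simp_rw [hT]
  rw [orthoSum_eq _ T e he, ← sum_form_eq_trace (G z₀) e he,
    ← sum_form_mul_of_isOrthonormalFor (G z₀) e he (Q z₀) (Q z₀), ← Finset.sum_sub_distrib,
    Finset.mul_sum, ← Finset.sum_add_distrib]
  refine Finset.sum_congr rfl fun i _ => ?_
  rw [← hT, hG.symm.self_of_nhds (e i) (localNablaL G Q z₀ (e i)),
    hG.symm.self_of_nhds (Q z₀) (e i)]

end Local

/-! ### Warped products in coordinates -/

section Warped

variable {E₁ : Type*} [NormedAddCommGroup E₁] [NormedSpace ℝ E₁]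
  {E₂ : Type*} [NormedAddCommGroup E₂] [NormedSpace ℝ E₂]

/-- The warped product metric in product coordinates. -/
def localWarped (G₁ : E₁ → E₁ →L[ℝ] E₁ →L[ℝ] ℝ) (G₂ : E₂ → E₂ →L[ℝ] E₂ →L[ℝ] ℝ) (φ : E₁ → ℝ)
    (z : E₁ × E₂) : E₁ × E₂ →L[ℝ] E₁ × E₂ →L[ℝ] ℝ :=
  pullbackForm (G₁ z.1) (ContinuousLinearMap.fst ℝ E₁ E₂) +
    (φ z.1 ^ 2) • pullbackForm (G₂ z.2) (ContinuousLinearMap.snd ℝ E₁ E₂)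

variable {G₁ : E₁ → E₁ →L[ℝ] E₁ →L[ℝ] ℝ} {G₂ : E₂ → E₂ →L[ℝ] E₂ →L[ℝ] ℝ} {φ : E₁ → ℝ}
  {z₁ : E₁} {z₂ : E₂}

theorem localWarped_apply (z u v : E₁ × E₂) :
    localWarped G₁ G₂ φ z u v = G₁ z.1 u.1 v.1 + φ z.1 ^ 2 * G₂ z.2 u.2 v.2 := rfl

theorem contDiffAt_pullbackForm {X V W : Type*} [NormedAddCommGroup X] [NormedSpace ℝ X]
    [NormedAddCommGroup V] [NormedSpace ℝ V] [NormedAddCommGroup W] [NormedSpace ℝ W]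
    {b : X → W →L[ℝ] W →L[ℝ] ℝ} {A : V →L[ℝ] W} {x : X} {n : WithTop ℕ∞}
    (hb : ContDiffAt ℝ n b x) : ContDiffAt ℝ n (fun x => pullbackForm (b x) A) x := by
  unfold pullbackForm
  exact (contDiffAt_const.clm_comp hb).clm_comp contDiffAt_const

theorem IsMetricNear.localWarped (h₁ : IsMetricNear G₁ z₁) (h₂ : IsMetricNear G₂ z₂)
    (hφ : ContDiffAt ℝ 2 φ z₁) (hpos : 0 < φ z₁) :
    IsMetricNear (localWarped G₁ G₂ φ) (z₁, z₂) := by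
  have e₁ : ∀ᶠ z : E₁ × E₂ in 𝓝 (z₁, z₂), IsMetricNear G₁ z.1 :=
    (continuousAt_fst (p := (z₁, z₂))).eventually h₁.eventually
  have e₂ : ∀ᶠ z : E₁ × E₂ in 𝓝 (z₁, z₂), IsMetricNear G₂ z.2 :=
    (continuousAt_snd (p := (z₁, z₂))).eventually h₂.eventually
  have e₃ : ∀ᶠ z : E₁ × E₂ in 𝓝 (z₁, z₂), 0 < φ z.1 :=
    (continuousAt_fst (p := (z₁, z₂))).eventually (hφ.continuousAt.eventually_const_lt hpos)
  refine ⟨?_, ?_, ?_⟩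
  · have c₁ : ContDiffAt ℝ 2 (fun z : E₁ × E₂ => G₁ z.1) (z₁, z₂) :=
      h₁.contDiffAt.comp (z₁, z₂) contDiffAt_fst
    have c₂ : ContDiffAt ℝ 2 (fun z : E₁ × E₂ => G₂ z.2) (z₁, z₂) :=
      h₂.contDiffAt.comp (z₁, z₂) contDiffAt_snd
    have c₃ : ContDiffAt ℝ 2 (fun z : E₁ × E₂ => φ z.1) (z₁, z₂) :=
      hφ.comp (z₁, z₂) contDiffAt_fst
    exact (contDiffAt_pullbackForm c₁).add ((c₃.pow 2).smul (contDiffAt_pullbackForm c₂))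
  · filter_upwards [e₁, e₂] with z a₁ a₂ u v
    rw [localWarped_apply, localWarped_apply, a₁.symm.self_of_nhds u.1, a₂.symm.self_of_nhds u.2]
  · filter_upwards [e₁, e₂, e₃] with z a₁ a₂ a₃ v hv
    rw [localWarped_apply]
    have n₁ : ∀ w, 0 ≤ G₁ z.1 w w := fun w => by
      by_cases h : w = 0
      · simp [h]
      · exact (a₁.pos.self_of_nhds w h).le
    have n₂ : ∀ w, 0 ≤ G₂ z.2 w w := fun w => by
      by_cases h : w = 0
      · simp [h]
      · exact (a₂.pos.self_of_nhds w h).le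
    by_cases h : v.1 = 0
    · have h' : v.2 ≠ 0 := fun h' => hv (Prod.ext h h')
      have := a₂.pos.self_of_nhds _ h'
      have := n₁ v.1
      positivity
    · have := a₁.pos.self_of_nhds _ h
      have := n₂ v.2
      positivity

theorem fderiv_localWarped (h₁ : IsMetricNear G₁ z₁) (h₂ : IsMetricNear G₂ z₂)
    (hφ : ContDiffAt ℝ 2 φ z₁) (hpos : 0 < φ z₁) (x u v : E₁ × E₂) :
    fderiv ℝ (localWarped G₁ G₂ φ) (z₁, z₂) x u v =
      fderiv ℝ G₁ z₁ x.1 u.1 v.1 + φ z₁ ^ 2 * fderiv ℝ G₂ z₂ x.2 u.2 v.2 +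
        2 * φ z₁ * fderiv ℝ φ z₁ x.1 * G₂ z₂ u.2 v.2 := by
  have hW := (h₁.localWarped h₂ hφ hpos).differentiableAt
  have k : HasFDerivAt (fun z => localWarped G₁ G₂ φ z u v)
      (((fderiv ℝ (localWarped G₁ G₂ φ) (z₁, z₂)).flip u).flip v) (z₁, z₂) := by
    refine ((hW.hasFDerivAt.clm_apply (hasFDerivAt_const u _)).clm_apply
      (hasFDerivAt_const v _)).congr_fderiv ?_
    ext <;> simp
  have k₁ : HasFDerivAt (fun z => G₁ z u.1 v.1) (((fderiv ℝ G₁ z₁).flip u.1).flip v.1) z₁ := by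
    refine ((h₁.differentiableAt.hasFDerivAt.clm_apply (hasFDerivAt_const u.1 _)).clm_apply
      (hasFDerivAt_const v.1 _)).congr_fderiv ?_
    ext; simp
  have k₂ : HasFDerivAt (fun z => G₂ z u.2 v.2) (((fderiv ℝ G₂ z₂).flip u.2).flip v.2) z₂ := by
    refine ((h₂.differentiableAt.hasFDerivAt.clm_apply (hasFDerivAt_const u.2 _)).clm_apply
      (hasFDerivAt_const v.2 _)).congr_fderiv ?_
    ext; simp
  have k₃ := (hφ.differentiableAt (by norm_num)).hasFDerivAt
  have q₁ : HasFDerivAt (fun z : E₁ × E₂ => G₁ z.1 u.1 v.1)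
      ((((fderiv ℝ G₁ z₁).flip u.1).flip v.1).comp (ContinuousLinearMap.fst ℝ E₁ E₂)) (z₁, z₂) :=
    HasFDerivAt.comp (g := fun z => G₁ z u.1 v.1) (z₁, z₂) k₁ hasFDerivAt_fst
  have q₂ : HasFDerivAt (fun z : E₁ × E₂ => G₂ z.2 u.2 v.2)
      ((((fderiv ℝ G₂ z₂).flip u.2).flip v.2).comp (ContinuousLinearMap.snd ℝ E₁ E₂)) (z₁, z₂) :=
    HasFDerivAt.comp (g := fun z => G₂ z u.2 v.2) (z₁, z₂) k₂ hasFDerivAt_snd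
  have q₃ : HasFDerivAt (fun z : E₁ × E₂ => φ z.1)
      ((fderiv ℝ φ z₁).comp (ContinuousLinearMap.fst ℝ E₁ E₂)) (z₁, z₂) :=
    k₃.comp (z₁, z₂) hasFDerivAt_fst
  have q : HasFDerivAt (fun z => localWarped G₁ G₂ φ z u v) _ (z₁, z₂) :=
    q₁.add ((q₃.pow 2).mul q₂)
  have := congrArg (fun L => L x) (k.unique q)
  simp only [ContinuousLinearMap.flip_apply] at this
  rw [this]
  simp [pullbackForm_apply]
  ring

variable [FiniteDimensional ℝ E₁] [FiniteDimensional ℝ E₂]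

/-- The formula is checked against the Koszul identity: the base identity plus φ² times the fibre
identity leaves only terms in dφ, which the gradient and the quotients dφ/φ supply. -/
theorem christoffel_localWarped (h₁ : IsMetricNear G₁ z₁) (h₂ : IsMetricNear G₂ z₂)
    (hφ : ContDiffAt ℝ 2 φ z₁) (hpos : 0 < φ z₁) (u v : E₁ × E₂) :
    christoffel (localWarped G₁ G₂ φ) (z₁, z₂) u v =
      (christoffel G₁ z₁ u.1 v.1 - (φ z₁ * G₂ z₂ u.2 v.2) • localGrad G₁ φ z₁,
        christoffel G₂ z₂ u.2 v.2 + (fderiv ℝ φ z₁ u.1 / φ z₁) • v.2 +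
          (fderiv ℝ φ z₁ v.1 / φ z₁) • u.2) := by
  refine christoffel_eq_of_forall (h₁.localWarped h₂ hφ hpos).pos.self_of_nhds fun w => ?_
  have c₁ := two_mul_christoffel G₁ z₁ u.1 v.1 w.1 (isInvertible_of_pos _ h₁.pos.self_of_nhds)
  have c₂ := two_mul_christoffel G₂ z₂ u.2 v.2 w.2 (isInvertible_of_pos _ h₂.pos.self_of_nhds)
  simp only [fderiv_localWarped h₁ h₂ hφ hpos, localWarped_apply, map_add, map_sub, map_smul,
    add_apply, sub_apply, smul_apply, smul_eq_mul, h₁.apply_localGrad]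
  have hne := hpos.ne'
  field_simp
  linear_combination c₁ + φ z₁ ^ 2 * c₂

end Warped

/-! ### Ricci tensor of a warped product in coordinates -/

section Warped

theorem IsMetricNear.fderiv_christoffelL_apply
    {E : Type*} [NormedAddCommGroup E] [NormedSpace ℝ E] [FiniteDimensional ℝ E]
    {G : E → E →L[ℝ] E →L[ℝ] ℝ} {z₀ : E} (hG : IsMetricNear G z₀) {v w : E} {g : E → E}
    {g' : E →L[ℝ] E} (h : ∀ᶠ z in 𝓝 z₀, christoffel G z v w = g z) (hg : HasFDerivAt g g' z₀)
    (u : E) : fderiv ℝ (christoffelL G) z₀ u v w = g' u := by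
  have := (hG.hasFDerivAt_christoffel v w).unique (hg.congr_of_eventuallyEq h)
  simpa using congrArg (fun L => L u) this

variable {E₁ : Type*} [NormedAddCommGroup E₁] [NormedSpace ℝ E₁] [FiniteDimensional ℝ E₁]
  {E₂ : Type*} [NormedAddCommGroup E₂] [NormedSpace ℝ E₂] [FiniteDimensional ℝ E₂]
  {G₁ : E₁ → E₁ →L[ℝ] E₁ →L[ℝ] ℝ} {G₂ : E₂ → E₂ →L[ℝ] E₂ →L[ℝ] ℝ} {φ : E₁ → ℝ}
  {z₁ : E₁} {z₂ : E₂}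

/-- Curvature differentiates the symbols, so their formula is needed on a neighbourhood. -/
theorem eventually_christoffel_localWarped (h₁ : IsMetricNear G₁ z₁) (h₂ : IsMetricNear G₂ z₂)
    (hφ : ContDiffAt ℝ 2 φ z₁) (hpos : 0 < φ z₁) (u v : E₁ × E₂) :
    ∀ᶠ z in 𝓝 (z₁, z₂), christoffel (localWarped G₁ G₂ φ) z u v =
      (christoffel G₁ z.1 u.1 v.1 - (φ z.1 * G₂ z.2 u.2 v.2) • localGrad G₁ φ z.1,
        christoffel G₂ z.2 u.2 v.2 + (fderiv ℝ φ z.1 u.1 / φ z.1) • v.2 +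
          (fderiv ℝ φ z.1 v.1 / φ z.1) • u.2) := by
  filter_upwards [(continuousAt_fst (p := (z₁, z₂))).eventually h₁.eventually,
    (continuousAt_snd (p := (z₁, z₂))).eventually h₂.eventually,
    (continuousAt_fst (p := (z₁, z₂))).eventually (hφ.eventually (by simp)),
    (continuousAt_fst (p := (z₁, z₂))).eventually (hφ.continuousAt.eventually_const_lt hpos)]
    with z a b c d
  exact christoffel_localWarped a b c d u v

/-- The derivative of the Christoffel symbols of a warped product. -/
theorem fderiv_christoffelL_localWarped (h₁ : IsMetricNear G₁ z₁) (h₂ : IsMetricNear G₂ z₂)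
    (hφ : ContDiffAt ℝ 2 φ z₁) (hpos : 0 < φ z₁) (x u v : E₁ × E₂) :
    fderiv ℝ (christoffelL (localWarped G₁ G₂ φ)) (z₁, z₂) x u v =
      (fderiv ℝ (christoffelL G₁) z₁ x.1 u.1 v.1
        - ((φ z₁ * fderiv ℝ G₂ z₂ x.2 u.2 v.2 + fderiv ℝ φ z₁ x.1 * G₂ z₂ u.2 v.2) •
            localGrad G₁ φ z₁
          + (φ z₁ * G₂ z₂ u.2 v.2) • fderiv ℝ (localGrad G₁ φ) z₁ x.1),
        fderiv ℝ (christoffelL G₂) z₂ x.2 u.2 v.2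
        + (fderiv ℝ (fun z => fderiv ℝ φ z u.1) z₁ x.1 / φ z₁
            - fderiv ℝ φ z₁ u.1 * fderiv ℝ φ z₁ x.1 / φ z₁ ^ 2) • v.2
        + (fderiv ℝ (fun z => fderiv ℝ φ z v.1) z₁ x.1 / φ z₁
            - fderiv ℝ φ z₁ v.1 * fderiv ℝ φ z₁ x.1 / φ z₁ ^ 2) • u.2) := by
  have p₁ : HasFDerivAt (fun z : E₁ × E₂ => z.1) (ContinuousLinearMap.fst ℝ E₁ E₂) (z₁, z₂) :=
    hasFDerivAt_fst
  have p₂ : HasFDerivAt (fun z : E₁ × E₂ => z.2) (ContinuousLinearMap.snd ℝ E₁ E₂) (z₁, z₂) :=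
    hasFDerivAt_snd
  have a₁ : HasFDerivAt (fun z : E₁ × E₂ => christoffel G₁ z.1 u.1 v.1)
      ((((fderiv ℝ (christoffelL G₁) z₁).flip u.1).flip v.1).comp
        (ContinuousLinearMap.fst ℝ E₁ E₂)) (z₁, z₂) :=
    HasFDerivAt.comp (g := fun z => christoffel G₁ z u.1 v.1) (z₁, z₂)
      (h₁.hasFDerivAt_christoffel u.1 v.1) p₁
  have a₂ : HasFDerivAt (fun z : E₁ × E₂ => christoffel G₂ z.2 u.2 v.2)
      ((((fderiv ℝ (christoffelL G₂) z₂).flip u.2).flip v.2).comp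
        (ContinuousLinearMap.snd ℝ E₁ E₂)) (z₁, z₂) :=
    HasFDerivAt.comp (g := fun z => christoffel G₂ z u.2 v.2) (z₁, z₂)
      (h₂.hasFDerivAt_christoffel u.2 v.2) p₂
  have k₂ : HasFDerivAt (fun z => G₂ z u.2 v.2) (((fderiv ℝ G₂ z₂).flip u.2).flip v.2) z₂ := by
    refine ((h₂.differentiableAt.hasFDerivAt.clm_apply (hasFDerivAt_const u.2 _)).clm_apply
      (hasFDerivAt_const v.2 _)).congr_fderiv ?_
    ext; simp
  have q₂ : HasFDerivAt (fun z : E₁ × E₂ => G₂ z.2 u.2 v.2)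
      ((((fderiv ℝ G₂ z₂).flip u.2).flip v.2).comp (ContinuousLinearMap.snd ℝ E₁ E₂)) (z₁, z₂) :=
    HasFDerivAt.comp (g := fun z => G₂ z u.2 v.2) (z₁, z₂) k₂ p₂
  have q₃ : HasFDerivAt (fun z : E₁ × E₂ => φ z.1)
      ((fderiv ℝ φ z₁).comp (ContinuousLinearMap.fst ℝ E₁ E₂)) (z₁, z₂) :=
    HasFDerivAt.comp (g := φ) (z₁, z₂) (hφ.differentiableAt (by norm_num)).hasFDerivAt p₁
  have q₄ : HasFDerivAt (fun z : E₁ × E₂ => localGrad G₁ φ z.1)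
      ((fderiv ℝ (localGrad G₁ φ) z₁).comp (ContinuousLinearMap.fst ℝ E₁ E₂)) (z₁, z₂) :=
    HasFDerivAt.comp (g := localGrad G₁ φ) (z₁, z₂)
      ((h₁.contDiffAt_localGrad hφ).differentiableAt (by norm_num)).hasFDerivAt p₁
  have q₅ : ∀ y : E₁, HasFDerivAt (fun z : E₁ × E₂ => fderiv ℝ φ z.1 y)
      ((fderiv ℝ (fun z => fderiv ℝ φ z y) z₁).comp (ContinuousLinearMap.fst ℝ E₁ E₂))
      (z₁, z₂) := fun y => by
    have hd : DifferentiableAt ℝ (fderiv ℝ φ) z₁ :=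
      (hφ.fderiv_right (m := 1) (by norm_num)).differentiableAt (by norm_num)
    exact HasFDerivAt.comp (g := fun z => fderiv ℝ φ z y) (z₁, z₂)
      (hd.clm_apply (differentiableAt_const y)).hasFDerivAt p₁
  have hne : φ z₁ ≠ 0 := hpos.ne'
  have q₆ : HasFDerivAt (fun z : E₁ × E₂ => (φ z.1)⁻¹)
      (-(φ z₁ ^ 2)⁻¹ • (fderiv ℝ φ z₁).comp (ContinuousLinearMap.fst ℝ E₁ E₂)) (z₁, z₂) :=
    (hasDerivAt_inv hne).comp_hasFDerivAt (z₁, z₂) q₃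
  have q : HasFDerivAt (fun z : E₁ × E₂ =>
      (christoffel G₁ z.1 u.1 v.1 - (φ z.1 * G₂ z.2 u.2 v.2) • localGrad G₁ φ z.1,
        christoffel G₂ z.2 u.2 v.2 + (fderiv ℝ φ z.1 u.1 * (φ z.1)⁻¹) • v.2 +
          (fderiv ℝ φ z.1 v.1 * (φ z.1)⁻¹) • u.2)) _ (z₁, z₂) :=
    (a₁.sub ((q₃.mul q₂).smul q₄)).prodMk
      ((a₂.add (((q₅ u.1).mul q₆).smul_const v.2)).add (((q₅ v.1).mul q₆).smul_const u.2))
  rw [(h₁.localWarped h₂ hφ hpos).fderiv_christoffelL_apply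
    (by simpa only [div_eq_mul_inv] using eventually_christoffel_localWarped h₁ h₂ hφ hpos u v)
    q x]
  refine Prod.ext ?_ ?_
  · simp
    module
  · simp
    module

/-- The Ricci tensor of a warped product on vectors tangent to the base. -/
theorem localRicci_localWarped_base (h₁ : IsMetricNear G₁ z₁) (h₂ : IsMetricNear G₂ z₂)
    (hφ : ContDiffAt ℝ 2 φ z₁) (hpos : 0 < φ z₁) (u v : E₁) :
    localRicci (localWarped G₁ G₂ φ) (z₁, z₂) (u, 0) (v, 0) =
      localRicci G₁ z₁ u v + Module.finrank ℝ E₂ * (localHess G₁ φ z₁ u v / φ z₁) := by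
  have hz : ∀ a : E₂, christoffel G₂ z₂ a 0 = 0 := fun a => by simp [← christoffelL_apply]
  have hz' : ∀ a : E₂, christoffel G₂ z₂ 0 a = 0 := fun a => by simp [← christoffelL_apply]
  have hz₁ : ∀ a : E₁, christoffel G₁ z₁ a 0 = 0 := fun a => by simp [← christoffelL_apply]
  have hz₁' : ∀ a : E₁, christoffel G₁ z₁ 0 a = 0 := fun a => by simp [← christoffelL_apply]
  -- The base block is the curvature of the base; the fibre block below is a multiple of the
  -- identity, and its trace brings in the fibre dimension.
  have A : LinearMap.fst ℝ E₁ E₂ ∘ₗ localRiemL (localWarped G₁ G₂ φ) (z₁, z₂) (u, 0) (v, 0) ∘ₗ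
      LinearMap.inl ℝ E₁ E₂ = localRiemL G₁ z₁ u v := by
    ext e
    change (localRiem (localWarped G₁ G₂ φ) (z₁, z₂) (u, 0) (e, 0) (v, 0)).1 =
      localRiem G₁ z₁ u e v
    simp [localRiem, fderiv_christoffelL_localWarped h₁ h₂ hφ hpos,
      christoffel_localWarped h₁ h₂ hφ hpos, hz]
  have B : LinearMap.snd ℝ E₁ E₂ ∘ₗ localRiemL (localWarped G₁ G₂ φ) (z₁, z₂) (u, 0) (v, 0) ∘ₗ
      LinearMap.inr ℝ E₁ E₂ = (localHess G₁ φ z₁ u v / φ z₁) • LinearMap.id := by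
    ext e
    change (localRiem (localWarped G₁ G₂ φ) (z₁, z₂) (u, 0) (0, e) (v, 0)).2 =
      (localHess G₁ φ z₁ u v / φ z₁) • e
    simp only [localRiem, fderiv_christoffelL_localWarped h₁ h₂ hφ hpos,
      christoffel_localWarped h₁ h₂ hφ hpos, hz, hz', hz₁', localHess]
    have hne := hpos.ne'
    simp [hz, hz₁, smul_smul, ← add_smul, ← sub_smul]
    congr 1
    field_simp
    ring
  rw [localRicci, trace_prod, A, B, map_smul, LinearMap.trace_id, smul_eq_mul, localRicci]
  ring

/-- The Ricci tensor of a warped product on vectors tangent to the fibre. -/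
theorem localRicci_localWarped_fibre (h₁ : IsMetricNear G₁ z₁) (h₂ : IsMetricNear G₂ z₂)
    (hφ : ContDiffAt ℝ 2 φ z₁) (hpos : 0 < φ z₁) (u v : E₂) :
    localRicci (localWarped G₁ G₂ φ) (z₁, z₂) (0, u) (0, v) =
      localRicci G₂ z₂ u v + (φ z₁ * LinearMap.trace ℝ E₁ (localNablaL G₁ (localGrad G₁ φ) z₁) +
        (Module.finrank ℝ E₂ - 1) * G₁ z₁ (localGrad G₁ φ z₁) (localGrad G₁ φ z₁)) *
          G₂ z₂ u v := by
  have hz' : ∀ a : E₂, christoffel G₂ z₂ 0 a = 0 := fun a => by simp [← christoffelL_apply]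
  have hz₁ : ∀ a : E₁, christoffel G₁ z₁ a 0 = 0 := fun a => by simp [← christoffelL_apply]
  have hz₁' : ∀ a : E₁, christoffel G₁ z₁ 0 a = 0 := fun a => by simp [← christoffelL_apply]
  have hne := hpos.ne'
  have A : LinearMap.fst ℝ E₁ E₂ ∘ₗ localRiemL (localWarped G₁ G₂ φ) (z₁, z₂) (0, u) (0, v) ∘ₗ
      LinearMap.inl ℝ E₁ E₂ =
      (φ z₁ * G₂ z₂ u v) • localNablaL G₁ (localGrad G₁ φ) z₁ := by
    ext e
    change (localRiem (localWarped G₁ G₂ φ) (z₁, z₂) (0, u) (e, 0) (0, v)).1 =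
      (φ z₁ * G₂ z₂ u v) • localNablaL G₁ (localGrad G₁ φ) z₁ e
    have hs : ∀ (c : ℝ) (a : E₁), christoffel G₁ z₁ e (0 - c • a) =
      -(c • christoffel G₁ z₁ e a) := fun c a => by simp [← christoffelL_apply]
    simp only [localRiem, fderiv_christoffelL_localWarped h₁ h₂ hφ hpos,
      christoffel_localWarped h₁ h₂ hφ hpos, hz', hz₁, hz₁', hs, localNablaL_apply, localNabla]
    simp
    -- Cancelling φ makes the contribution of Γ(u, Γ(e, v)) opposite to the one from differentiating
    -- the factor φ, which leaves the multiple of ∇_e grad φ.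
    rw [show φ z₁ * (fderiv ℝ φ z₁ e / φ z₁ * G₂ z₂ u v) = fderiv ℝ φ z₁ e * G₂ z₂ u v by
      field_simp]
    module
  -- The |grad φ|² terms arise because Γ of two fibre vectors has a base component along grad φ,
  -- which a second Γ sends back to the fibre.
  have B : LinearMap.snd ℝ E₁ E₂ ∘ₗ localRiemL (localWarped G₁ G₂ φ) (z₁, z₂) (0, u) (0, v) ∘ₗ
      LinearMap.inr ℝ E₁ E₂ = localRiemL G₂ z₂ u v +
        G₁ z₁ (localGrad G₁ φ z₁) (localGrad G₁ φ z₁) •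
          (G₂ z₂ u v • LinearMap.id - ((G₂ z₂).flip v : E₂ →ₗ[ℝ] ℝ).smulRight u) := by
    ext e
    change (localRiem (localWarped G₁ G₂ φ) (z₁, z₂) (0, u) (0, e) (0, v)).2 =
      localRiem G₂ z₂ u e v + G₁ z₁ (localGrad G₁ φ z₁) (localGrad G₁ φ z₁) •
          (G₂ z₂ u v • e - G₂ z₂ e v • u)
    rw [h₁.apply_localGrad]
    simp only [localRiem, fderiv_christoffelL_localWarped h₁ h₂ hφ hpos,
      christoffel_localWarped h₁ h₂ hφ hpos, hz₁, hz₁']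
    simp
    rw [mul_assoc, mul_assoc, neg_div, neg_div, mul_div_cancel_left₀ _ hne,
      mul_div_cancel_left₀ _ hne]
    module
  rw [localRicci, trace_prod, A, B, map_add, map_smul, map_smul, map_sub, map_smul,
    LinearMap.trace_id, LinearMap.trace_smulRight, localRicci]
  simp only [smul_eq_mul, ContinuousLinearMap.coe_coe, ContinuousLinearMap.flip_apply]
  ring

end Warped

/-! ### Passage between the manifold and its preferred charts -/

section Manifold

variable {E : Type*} [NormedAddCommGroup E] [NormedSpace ℝ E]
  {H : Type*} [TopologicalSpace H] {I : ModelWithCorners ℝ E H} [I.Boundaryless]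
  {M : Type*} [TopologicalSpace M] [ChartedSpace H M]

/-- The chart at `p` read in itself is the identity near `p`. -/
theorem eventually_extChartAt_symm (p : M) :
    ∀ᶠ z in 𝓝 (extChartAt I p p), extChartAt I p ((extChartAt I p).symm z) = z :=
  Filter.mem_of_superset (extChartAt_target_mem_nhds p) fun _ hz => (extChartAt I p).right_inv hz

theorem fderiv_comp_extChartAt_symm {f : M → ℝ} {p : M} (hf : MDifferentiableAt I 𝓘(ℝ, ℝ) f p) :
    fderiv ℝ (f ∘ (extChartAt I p).symm) (extChartAt I p p) = mfderiv I 𝓘(ℝ, ℝ) f p := by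
  refine Eq.trans ?_ hf.mfderiv.symm
  rw [ModelWithCorners.Boundaryless.range_eq_univ, fderivWithin_univ]
  rfl

variable [IsManifold I ∞ M]

/-- The tangent space at p is modelled on E through the preferred chart at p, and that chart read in
itself is the identity. -/
theorem chartDeriv_eq (p : M) : chartDeriv I p = ContinuousLinearMap.id ℝ E := by
  have hd : MDifferentiableAt I 𝓘(ℝ, E) (extChartAt I p) p :=
    mdifferentiableAt_extChartAt (mem_chart_source H p)
  refine Eq.trans hd.mfderiv ?_
  rw [ModelWithCorners.Boundaryless.range_eq_univ, fderivWithin_univ]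
  refine Eq.trans (Filter.EventuallyEq.fderiv_eq ?_) fderiv_id
  exact eventually_extChartAt_symm p

theorem mdifferentiableAt_extChartAt_symm {p : M} {z : E} (hz : z ∈ (extChartAt I p).target) :
    MDifferentiableAt 𝓘(ℝ, E) I (extChartAt I p).symm z := by
  have := mdifferentiableWithinAt_extChartAt_symm (I := I) hz
  rwa [ModelWithCorners.Boundaryless.range_eq_univ, mdifferentiableWithinAt_univ] at this

theorem isInvertible_mfderiv_extChartAt_symm {p : M} {z : E} (hz : z ∈ (extChartAt I p).target) :
    (mfderiv 𝓘(ℝ, E) I (extChartAt I p).symm z).IsInvertible := by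
  have := isInvertible_mfderivWithin_extChartAt_symm (I := I) hz
  rwa [ModelWithCorners.Boundaryless.range_eq_univ, mfderivWithin_univ] at this

theorem mfderiv_extChartAt_symm_self (p : M) (u : E) :
    (mfderiv 𝓘(ℝ, E) I (extChartAt I p).symm (extChartAt I p p) u : E) = u := by
  have h := mfderivWithin_extChartAt_symm_comp_mfderiv_extChartAt' (I := I)
    (mem_extChartAt_source (I := I) p)
  rw [ModelWithCorners.Boundaryless.range_eq_univ, mfderivWithin_univ] at h
  have h' := congrArg (fun L => L (u : TangentSpace I p)) h
  have hc : (mfderiv I 𝓘(ℝ, E) (extChartAt I p) p (u : TangentSpace I p) : E) = u :=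
    congrArg (fun L : E →L[ℝ] E => L u) (chartDeriv_eq (I := I) p)
  change (mfderiv 𝓘(ℝ, E) I (extChartAt I p).symm (extChartAt I p p))
    (mfderiv I 𝓘(ℝ, E) (extChartAt I p) p (u : TangentSpace I p)) = (u : E) at h'
  rwa [hc] at h'

theorem chartMetric_self (g : (p : M) → TangentSpace I p →L[ℝ] TangentSpace I p →L[ℝ] ℝ) (p : M) :
    chartMetric g p (extChartAt I p p) = g p := by
  let g' : M → E →L[ℝ] E →L[ℝ] ℝ := g
  let D : E →L[ℝ] E := mfderiv 𝓘(ℝ, E) I (extChartAt I p).symm (extChartAt I p p)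
  have hD : ∀ u, D u = u := mfderiv_extChartAt_symm_self p
  refine ContinuousLinearMap.ext fun u => ContinuousLinearMap.ext fun v => ?_
  change g' ((extChartAt I p).symm (extChartAt I p p)) (D u) (D v) = g' p u v
  rw [hD, hD, extChartAt_to_inv]

theorem chartField_self (P : (p : M) → TangentSpace I p) (p : M) :
    chartField P p (extChartAt I p p) = P p := by
  let P' : M → E := P
  let D : E →L[ℝ] E := mfderiv 𝓘(ℝ, E) I (extChartAt I p).symm (extChartAt I p p)
  have hD : D = ContinuousLinearMap.id ℝ E :=
    ContinuousLinearMap.ext (mfderiv_extChartAt_symm_self p)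
  change D.inverse (P' ((extChartAt I p).symm (extChartAt I p p))) = P' p
  rw [hD, extChartAt_to_inv, ContinuousLinearMap.inverse_id]
  rfl

theorem natCast_le_infty (k : ℕ) : (k : WithTop ℕ∞) ≤ ∞ := by
  exact_mod_cast (le_top : (k : ℕ∞) ≤ ⊤)

theorem contMDiffAt_extChartAt_symm (p : M) :
    ContMDiffAt 𝓘(ℝ, E) I ∞ (extChartAt I p).symm (extChartAt I p p) :=
  (contMDiffOn_extChartAt_symm p).contMDiffAt (extChartAt_target_mem_nhds p)

/-- Regularity of the coordinate frame, against which the metric tensor is evaluated to get its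
coefficients. -/
theorem contMDiffAt_mfderiv_extChartAt_symm (p : M) (v : E) :
    ContMDiffAt 𝓘(ℝ, E) I.tangent 2 (fun z => (⟨(extChartAt I p).symm z,
      mfderiv 𝓘(ℝ, E) I (extChartAt I p).symm z v⟩ : TangentBundle I M)) (extChartAt I p p) := by
  have h1 := (contMDiffAt_extChartAt_symm (I := I) p).mfderiv_const (m := 2)
    (natCast_le_infty 3)
  have h2 : ContMDiffAt 𝓘(ℝ, E) 𝓘(ℝ, E).tangent 2
      (fun z : E => (⟨z, v⟩ : TangentBundle 𝓘(ℝ, E) E)) (extChartAt I p p) :=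
    contMDiffAt_vectorSpace_iff_contDiffAt.2 contDiffAt_const
  exact ContMDiffAt.clm_apply_of_inCoordinates h1 h2
    ((contMDiffAt_extChartAt_symm (I := I) p).of_le (natCast_le_infty 2))

theorem contDiffAt_comp_extChartAt_symm {f : M → ℝ} (hf : ContMDiff I 𝓘(ℝ, ℝ) ∞ f) (p : M) :
    ContDiffAt ℝ 2 (f ∘ (extChartAt I p).symm) (extChartAt I p p) :=
  (contMDiffAt_iff_contDiffAt.1
    (hf.contMDiffAt.comp _ (contMDiffAt_extChartAt_symm p))).of_le (natCast_le_infty 2)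

variable {g : (p : M) → TangentSpace I p →L[ℝ] TangentSpace I p →L[ℝ] ℝ}
  {P : (p : M) → TangentSpace I p} {p : M}

theorem curvatureBar_eq (u v w : E) :
    curvatureBar g P p u v w = localCurvature (localNablaBar (chartMetric g p) (chartField P p))
      (fun _ => u) (fun _ => v) (fun _ => w) (extChartAt I p p) := by
  -- The chart derivative is replaced by a variable L, so that its equality with the identity can be
  -- substituted in every occurrence at once.
  have aux : ∀ (L : E →L[ℝ] E) (D : (E → E) → (E → E) → E → E) (z : E),
      L = ContinuousLinearMap.id ℝ E →
      L.inverse (localCurvature D (fun _ => L u) (fun _ => L v) (fun _ => L w) z) =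
        localCurvature D (fun _ => u) (fun _ => v) (fun _ => w) z := by
    rintro _ D z rfl
    rw [ContinuousLinearMap.inverse_id]
    rfl
  exact aux _ _ _ (chartDeriv_eq p)

theorem gradVec_eq {f : M → ℝ} (hf : ContMDiff I 𝓘(ℝ, ℝ) ∞ f) :
    gradVec g f p =
      localGrad (chartMetric g p) (f ∘ (extChartAt I p).symm) (extChartAt I p p) := by
  rw [localGrad, fderiv_comp_extChartAt_symm (hf.contMDiffAt.mdifferentiableAt (by simp)),
    chartMetric_self]
  rfl

variable [FiniteDimensional ℝ E]

/-- With a finite-dimensional domain, a linear map is determined by its values on a basis, so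
regularity can be tested on vectors. -/
theorem contDiffAt_of_forall_clm_apply {X V W : Type*} [NormedAddCommGroup X] [NormedSpace ℝ X]
    [NormedAddCommGroup V] [NormedSpace ℝ V] [NormedAddCommGroup W] [NormedSpace ℝ W]
    [FiniteDimensional ℝ V] {f : X → V →L[ℝ] W} {x : X} {n : WithTop ℕ∞}
    (h : ∀ v, ContDiffAt ℝ n (fun y => f y v) x) : ContDiffAt ℝ n f x := by
  let d := Module.finrank ℝ V
  have hd : d = Module.finrank ℝ (Fin d → ℝ) := (Module.finrank_fin_fun ℝ).symm
  let e₁ := ContinuousLinearEquiv.ofFinrankEq hd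
  let e₂ := (e₁.arrowCongr (1 : W ≃L[ℝ] W)).trans (ContinuousLinearEquiv.piRing (Fin d))
  rw [← Function.id_comp f, ← e₂.symm_comp_self]
  exact e₂.symm.contDiff.contDiffAt.comp x (contDiffAt_pi.mpr fun i => h _)

theorem contDiffAt_chartMetric (g : ContMDiffRiemannianMetric I ∞ E
    (fun x : M => TangentSpace I x)) (p : M) :
    ContDiffAt ℝ 2 (chartMetric g.inner p) (extChartAt I p p) := by
  refine contDiffAt_of_forall_clm_apply fun u => contDiffAt_of_forall_clm_apply fun v => ?_
  have hg : ContMDiffAt 𝓘(ℝ, E) (I.prod 𝓘(ℝ, E →L[ℝ] E →L[ℝ] ℝ)) 2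
      (fun z => TotalSpace.mk' (E →L[ℝ] E →L[ℝ] ℝ)
        (E := fun x : M => TangentSpace I x →L[ℝ] TangentSpace I x →L[ℝ] ℝ)
        ((extChartAt I p).symm z) (g.inner ((extChartAt I p).symm z))) (extChartAt I p p) :=
    (g.contMDiff.contMDiffAt.comp _ (contMDiffAt_extChartAt_symm p)).of_le (natCast_le_infty 2)
  have h := ContMDiffAt.clm_bundle_apply₂ (E₃ := fun _ : M => ℝ) (F₃ := ℝ) hg
    (contMDiffAt_mfderiv_extChartAt_symm p u) (contMDiffAt_mfderiv_extChartAt_symm p v)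
  simp only [contMDiffAt_totalSpace] at h
  exact contMDiffAt_iff_contDiffAt.1 h.2

theorem isMetricNear_chartMetric (g : ContMDiffRiemannianMetric I ∞ E
    (fun x : M => TangentSpace I x)) (p : M) :
    IsMetricNear (chartMetric g.inner p) (extChartAt I p p) := by
  refine ⟨contDiffAt_chartMetric g p, ?_, ?_⟩
  · exact Eventually.of_forall fun z u v => g.symm _ _ _
  · filter_upwards [extChartAt_target_mem_nhds p] with z hz v hv
    refine g.pos _ _ fun h => hv ?_
    -- Positivity survives the pull-back because the derivative of the inverse chart is injective.
    exact (isInvertible_mfderiv_extChartAt_symm hz).injective (h.trans (map_zero _).symm)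

theorem differentiableAt_chartField {P : (p : M) → TangentSpace I p}
    (hP : ContMDiff I I.tangent ∞ (fun x => (⟨x, P x⟩ : TangentBundle I M))) (p : M) :
    DifferentiableAt ℝ (chartField P p) (extChartAt I p p) := by
  have : CompleteSpace E := FiniteDimensional.complete ℝ E
  have h : ContMDiffAt 𝓘(ℝ, E) 𝓘(ℝ, E).tangent 1
      (fun z => (⟨z, VectorField.mpullback 𝓘(ℝ, E) I (extChartAt I p).symm P z⟩ :
        TangentBundle 𝓘(ℝ, E) E)) (extChartAt I p p) :=
    ContMDiffAt.mpullback_vectorField_preimage (n := ∞)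
      (hP.contMDiffAt.of_le (natCast_le_infty 1)) (contMDiffAt_extChartAt_symm p)
      (isInvertible_mfderiv_extChartAt_symm (mem_extChartAt_target p)) (natCast_le_infty 2)
  exact (contMDiffAt_vectorSpace_iff_contDiffAt.1 h).differentiableAt (by norm_num)

/-! ### The invariants at a point in the preferred chart -/

theorem ricciBar_eq (hG : IsMetricNear (chartMetric g p) (extChartAt I p p))
    (hQ : DifferentiableAt ℝ (chartField P p) (extChartAt I p p)) (u v : E) :
    ricciBar g P p u v = localRicci (chartMetric g p) (extChartAt I p p) u v +
      ((Module.finrank ℝ E : ℝ) - 1) *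
      (chartMetric g p (extChartAt I p p) v
          (localNablaL (chartMetric g p) (chartField P p) (extChartAt I p p) u) -
        chartMetric g p (extChartAt I p p) u (chartField P p (extChartAt I p p)) *
          chartMetric g p (extChartAt I p p) v (chartField P p (extChartAt I p p))) := by
  rw [← hG.localRicciBar_eq hQ]
  have aux : ∀ (b b' : E →L[ℝ] E →L[ℝ] ℝ) (c c' : E → E), b = b' → c = c' →
      orthoSum b (fun e e' => b (c e) e') = orthoSum b' (fun e e' => b' (c' e) e') := by
    rintro b _ c _ rfl rfl; rfl
  exact aux _ _ _ _ (chartMetric_self g p).symm (funext fun e => curvatureBar_eq u e v)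

theorem scalarBar_eq (hG : IsMetricNear (chartMetric g p) (extChartAt I p p))
    (hQ : DifferentiableAt ℝ (chartField P p) (extChartAt I p p))
    {ι : Type*} [Fintype ι] (e : Module.Basis ι ℝ E)
    (he : IsOrthonormalFor (chartMetric g p (extChartAt I p p)) e) :
    scalarBar g P p = ∑ i, localRicci (chartMetric g p) (extChartAt I p p) (e i) (e i) +
      ((Module.finrank ℝ E : ℝ) - 1) *
      (LinearMap.trace ℝ E (localNablaL (chartMetric g p) (chartField P p) (extChartAt I p p)) -
        chartMetric g p (extChartAt I p p) (chartField P p (extChartAt I p p))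
          (chartField P p (extChartAt I p p))) := by
  rw [← hG.orthoSum_localRicciBar _ _ e he, scalarBar, ← chartMetric_self g p]
  refine congrArg (orthoSum (V := E) (chartMetric g p (extChartAt I p p))) ?_
  ext u v
  exact ricciBar_eq hG hQ u v

theorem divergence_eq (hG : IsMetricNear (chartMetric g p) (extChartAt I p p)) :
    divergence g P p =
      LinearMap.trace ℝ E (localNablaL (chartMetric g p) (chartField P p) (extChartAt I p p)) := by
  rw [← orthoSum_eq_trace _ hG.exists_isOrthonormalFor, divergence, ← chartMetric_self g p]
  refine congrArg (orthoSum (V := E) (chartMetric g p (extChartAt I p p))) ?_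
  ext u v
  have h : (nabla g p u P : E) =
      localNablaL (chartMetric g p) (chartField P p) (extChartAt I p p) u := by
    have aux : ∀ (L : E →L[ℝ] E) (D : E → E), L = ContinuousLinearMap.id ℝ E →
        L.inverse (D (L u)) = D u := by
      rintro _ D rfl
      rw [ContinuousLinearMap.inverse_id]
      rfl
    exact (aux _ (fun u => localNabla (chartMetric g p) (fun _ => u) (chartField P p)
      (extChartAt I p p)) (chartDeriv_eq p)).trans (localNablaL_apply _ _ _ _).symm
  exact congrArg (fun a : E => chartMetric g p (extChartAt I p p) a v) h

theorem laplacian_eq (hG : IsMetricNear (chartMetric g p) (extChartAt I p p)) {f : M → ℝ}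
    (hf : ContMDiff I 𝓘(ℝ, ℝ) ∞ f) :
    laplacian g f p = -LinearMap.trace ℝ E (localNablaL (chartMetric g p)
      (localGrad (chartMetric g p) (f ∘ (extChartAt I p).symm)) (extChartAt I p p)) := by
  rw [← hG.orthoSum_localHess (contDiffAt_comp_extChartAt_symm hf p), laplacian,
    ← chartMetric_self g p]
  refine congrArg (fun T => -orthoSum (V := E) (chartMetric g p (extChartAt I p p)) T) ?_
  ext u v
  unfold hessian
  change fderiv ℝ (fun z => fderiv ℝ (f ∘ (extChartAt I p).symm) z
      ((chartDeriv I p : E →L[ℝ] E) v)) (extChartAt I p p) ((chartDeriv I p : E →L[ℝ] E) u) -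
    fderiv ℝ (f ∘ (extChartAt I p).symm) (extChartAt I p p)
      (localNabla (chartMetric g p) (fun _ => (chartDeriv I p : E →L[ℝ] E) u)
        (fun _ => (chartDeriv I p : E →L[ℝ] E) v) (extChartAt I p p)) = _
  rw [chartDeriv_eq (I := I) p, localNabla_const]
  rfl

end Manifold

/-! ### Product charts -/

section Product

variable {E₁ : Type*} [NormedAddCommGroup E₁] [NormedSpace ℝ E₁]
  {H₁ : Type*} [TopologicalSpace H₁] {I₁ : ModelWithCorners ℝ E₁ H₁}
  {B : Type*} [TopologicalSpace B] [ChartedSpace H₁ B]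
  {E₂ : Type*} [NormedAddCommGroup E₂] [NormedSpace ℝ E₂]
  {H₂ : Type*} [TopologicalSpace H₂] {I₂ : ModelWithCorners ℝ E₂ H₂}
  {F : Type*} [TopologicalSpace F] [ChartedSpace H₂ F]

theorem mem_extChartAt_prod_target {x : B} {y : F} {z : E₁ × E₂}
    (hz₁ : z.1 ∈ (extChartAt I₁ x).target) (hz₂ : z.2 ∈ (extChartAt I₂ y).target) :
    z ∈ (extChartAt (I₁.prod I₂) (x, y)).target := by
  rw [extChartAt_prod]
  exact ⟨hz₁, hz₂⟩

theorem extChartAt_prod_symm_apply (x : B) (y : F) (z : E₁ × E₂) :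
    (extChartAt (I₁.prod I₂) (x, y)).symm z =
      ((extChartAt I₁ x).symm z.1, (extChartAt I₂ y).symm z.2) := by
  rw [extChartAt_prod]; rfl

theorem extChartAt_prod_self (x : B) (y : F) :
    extChartAt (I₁.prod I₂) (x, y) (x, y) = (extChartAt I₁ x x, extChartAt I₂ y y) := by
  rw [extChartAt_prod]; rfl

theorem warpedMetric_apply
    (gB : (x : B) → TangentSpace I₁ x →L[ℝ] TangentSpace I₁ x →L[ℝ] ℝ)
    (gF : (y : F) → TangentSpace I₂ y →L[ℝ] TangentSpace I₂ y →L[ℝ] ℝ) (f : B → ℝ)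
    (x : B) (y : F) (u v : E₁ × E₂) :
    warpedMetric gB gF f (x, y) u v = gB x u.1 v.1 + f x ^ 2 * gF y u.2 v.2 := by
  unfold warpedMetric
  rw [mfderiv_fst, mfderiv_snd]
  rfl

variable [I₁.Boundaryless] [I₂.Boundaryless]

theorem eventually_mem_extChartAt_target (x : B) (y : F) :
    ∀ᶠ z in 𝓝 (extChartAt I₁ x x, extChartAt I₂ y y),
      z.1 ∈ (extChartAt I₁ x).target ∧ z.2 ∈ (extChartAt I₂ y).target :=
  prod_mem_nhds (extChartAt_target_mem_nhds x) (extChartAt_target_mem_nhds y)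

variable [IsManifold I₁ ∞ B] [IsManifold I₂ ∞ F]

/-- The inverse product chart commutes with both projections; the chain rule and uniqueness of
derivatives give the components. -/
theorem mfderiv_extChartAt_prod_symm {x : B} {y : F} {z : E₁ × E₂}
    (hz₁ : z.1 ∈ (extChartAt I₁ x).target) (hz₂ : z.2 ∈ (extChartAt I₂ y).target) (v : E₁ × E₂) :
    (mfderiv 𝓘(ℝ, E₁ × E₂) (I₁.prod I₂) (extChartAt (I₁.prod I₂) (x, y)).symm z v : E₁ × E₂) =
      ((mfderiv 𝓘(ℝ, E₁) I₁ (extChartAt I₁ x).symm z.1 v.1 : E₁),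
        (mfderiv 𝓘(ℝ, E₂) I₂ (extChartAt I₂ y).symm z.2 v.2 : E₂)) := by
  have hs := mdifferentiableAt_extChartAt_symm (mem_extChartAt_prod_target hz₁ hz₂)
  have hp₁ : HasMFDerivAt 𝓘(ℝ, E₁ × E₂) 𝓘(ℝ, E₁) (Prod.fst : E₁ × E₂ → E₁) z
      (ContinuousLinearMap.fst ℝ E₁ E₂) := hasFDerivAt_fst.hasMFDerivAt
  have hp₂ : HasMFDerivAt 𝓘(ℝ, E₁ × E₂) 𝓘(ℝ, E₂) (Prod.snd : E₁ × E₂ → E₂) z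
      (ContinuousLinearMap.snd ℝ E₁ E₂) := hasFDerivAt_snd.hasMFDerivAt
  have e₁ : Prod.fst ∘ (extChartAt (I₁.prod I₂) (x, y)).symm =
      (extChartAt I₁ x).symm ∘ (Prod.fst : E₁ × E₂ → E₁) := by
    rw [extChartAt_prod]; rfl
  have e₂ : Prod.snd ∘ (extChartAt (I₁.prod I₂) (x, y)).symm =
      (extChartAt I₂ y).symm ∘ (Prod.snd : E₁ × E₂ → E₂) := by
    rw [extChartAt_prod]; rfl
  have a₁ := (hasMFDerivAt_fst (I := I₁) (I' := I₂)
    ((extChartAt (I₁.prod I₂) (x, y)).symm z)).comp z hs.hasMFDerivAt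
  have a₂ := (hasMFDerivAt_snd (I := I₁) (I' := I₂)
    ((extChartAt (I₁.prod I₂) (x, y)).symm z)).comp z hs.hasMFDerivAt
  have b₁ := (mdifferentiableAt_extChartAt_symm hz₁).hasMFDerivAt.comp z hp₁
  have b₂ := (mdifferentiableAt_extChartAt_symm hz₂).hasMFDerivAt.comp z hp₂
  rw [e₁] at a₁
  rw [e₂] at a₂
  have c₁ := hasMFDerivAt_unique a₁ b₁
  have c₂ := hasMFDerivAt_unique a₂ b₂
  exact Prod.ext (congrArg (fun L : E₁ × E₂ →L[ℝ] E₁ => L v) c₁)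
    (congrArg (fun L : E₁ × E₂ →L[ℝ] E₂ => L v) c₂)

theorem chartMetric_warpedMetric
    (gB : (x : B) → TangentSpace I₁ x →L[ℝ] TangentSpace I₁ x →L[ℝ] ℝ)
    (gF : (y : F) → TangentSpace I₂ y →L[ℝ] TangentSpace I₂ y →L[ℝ] ℝ) (f : B → ℝ)
    {x : B} {y : F} {z : E₁ × E₂}
    (hz₁ : z.1 ∈ (extChartAt I₁ x).target) (hz₂ : z.2 ∈ (extChartAt I₂ y).target) :
    chartMetric (warpedMetric gB gF f) (x, y) z =
      localWarped (chartMetric gB x) (chartMetric gF y) (f ∘ (extChartAt I₁ x).symm) z := by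
  let gB' : B → E₁ →L[ℝ] E₁ →L[ℝ] ℝ := gB
  let gF' : F → E₂ →L[ℝ] E₂ →L[ℝ] ℝ := gF
  let D : E₁ × E₂ →L[ℝ] E₁ × E₂ :=
    mfderiv 𝓘(ℝ, E₁ × E₂) (I₁.prod I₂) (extChartAt (I₁.prod I₂) (x, y)).symm z
  let D₁ : E₁ →L[ℝ] E₁ := mfderiv 𝓘(ℝ, E₁) I₁ (extChartAt I₁ x).symm z.1
  let D₂ : E₂ →L[ℝ] E₂ := mfderiv 𝓘(ℝ, E₂) I₂ (extChartAt I₂ y).symm z.2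
  have hD : ∀ v, D v = (D₁ v.1, D₂ v.2) := mfderiv_extChartAt_prod_symm hz₁ hz₂
  have hw : ∀ (p : B × F) (u v : E₁ × E₂), (warpedMetric gB gF f p : E₁ × E₂ →L[ℝ] E₁ × E₂ →L[ℝ] ℝ)
      u v = gB' p.1 u.1 v.1 + f p.1 ^ 2 * gF' p.2 u.2 v.2 := fun p u v => by
    unfold warpedMetric
    rw [mfderiv_fst, mfderiv_snd]
    rfl
  refine ContinuousLinearMap.ext fun u => ContinuousLinearMap.ext fun v => ?_
  refine (hw _ (D u) (D v)).trans ?_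
  rw [hD, hD, extChartAt_prod_symm_apply]
  rfl

theorem chartField_liftFromBase (P : (x : B) → TangentSpace I₁ x)
    {x : B} {y : F} {z : E₁ × E₂}
    (hz₁ : z.1 ∈ (extChartAt I₁ x).target) (hz₂ : z.2 ∈ (extChartAt I₂ y).target) :
    chartField (liftFromBase I₂ P) (x, y) z = ((chartField P x z.1 : E₁), (0 : E₂)) := by
  let P' : B → E₁ := P
  let D : E₁ × E₂ →L[ℝ] E₁ × E₂ :=
    mfderiv 𝓘(ℝ, E₁ × E₂) (I₁.prod I₂) (extChartAt (I₁.prod I₂) (x, y)).symm z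
  let D₁ : E₁ →L[ℝ] E₁ := mfderiv 𝓘(ℝ, E₁) I₁ (extChartAt I₁ x).symm z.1
  let D₂ : E₂ →L[ℝ] E₂ := mfderiv 𝓘(ℝ, E₂) I₂ (extChartAt I₂ y).symm z.2
  have hD : ∀ v, D v = (D₁ v.1, D₂ v.2) := mfderiv_extChartAt_prod_symm hz₁ hz₂
  have hi : D.IsInvertible :=
    isInvertible_mfderiv_extChartAt_symm (mem_extChartAt_prod_target hz₁ hz₂)
  have hi₁ : D₁.IsInvertible := isInvertible_mfderiv_extChartAt_symm hz₁
  let w : B × F → E₁ × E₂ := liftFromBase I₂ P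
  have hl : ∀ p, w p = (P' p.1, 0) := fun p => by
    change (liftFromBase I₂ P p : E₁ × E₂) = (P' p.1, 0)
    unfold liftFromBase
    rw [mfderiv_prod_left]
    rfl
  change D.inverse (w ((extChartAt (I₁.prod I₂) (x, y)).symm z)) =
    (D₁.inverse (P' ((extChartAt I₁ x).symm z.1)), 0)
  -- Instead of inverting the block-diagonal derivative, it is applied to the claimed preimage.
  rw [hi.inverse_apply_eq, hD, hi₁.self_apply_inverse, map_zero, extChartAt_prod_symm_apply, hl]

theorem chartMetric_warpedMetric_eventuallyEq
    (gB : (x : B) → TangentSpace I₁ x →L[ℝ] TangentSpace I₁ x →L[ℝ] ℝ)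
    (gF : (y : F) → TangentSpace I₂ y →L[ℝ] TangentSpace I₂ y →L[ℝ] ℝ) (f : B → ℝ)
    (x : B) (y : F) :
    chartMetric (warpedMetric gB gF f) (x, y)
      =ᶠ[𝓝 (extChartAt I₁ x x, extChartAt I₂ y y)]
    localWarped (chartMetric gB x) (chartMetric gF y)
      (f ∘ (extChartAt I₁ x).symm) :=
  (eventually_mem_extChartAt_target x y).mono fun _ hz =>
    chartMetric_warpedMetric gB gF f hz.1 hz.2

theorem chartField_liftFromBase_eventuallyEq (P : (x : B) → TangentSpace I₁ x)
    (x : B) (y : F) :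
    chartField (liftFromBase I₂ P) (x, y)
      =ᶠ[𝓝 (extChartAt I₁ x x, extChartAt I₂ y y)]
    fun z => ((chartField P x z.1 : E₁), (0 : E₂)) :=
  (eventually_mem_extChartAt_target x y).mono fun _ hz => chartField_liftFromBase P hz.1 hz.2

theorem warpedMetric_eq_chartMetric
    (gB : (x : B) → TangentSpace I₁ x →L[ℝ] TangentSpace I₁ x →L[ℝ] ℝ)
    (gF : (y : F) → TangentSpace I₂ y →L[ℝ] TangentSpace I₂ y →L[ℝ] ℝ) (f : B → ℝ)
    (x : B) (y : F) (u v : E₁ × E₂) :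
    warpedMetric gB gF f (x, y) u v =
      chartMetric gB x (extChartAt I₁ x x) u.1 v.1 +
        f x ^ 2 * chartMetric gF y (extChartAt I₂ y y) u.2 v.2 := by
  rw [chartMetric_self, chartMetric_self]
  exact warpedMetric_apply gB gF f x y u v

theorem IsQuasiEinstein.ricciBar_warpedMetric
    {gB : (x : B) → TangentSpace I₁ x →L[ℝ] TangentSpace I₁ x →L[ℝ] ℝ}
    {gF : (y : F) → TangentSpace I₂ y →L[ℝ] TangentSpace I₂ y →L[ℝ] ℝ} {f : B → ℝ}
    {P : (x : B) → TangentSpace I₁ x} {a b : B × F → ℝ}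
    {U : (p : B × F) → TangentSpace (I₁.prod I₂) p}
    (h : IsQuasiEinstein (warpedMetric gB gF f) (liftFromBase I₂ P) a b U)
    (x : B) (y : F) {w : E₁ × E₂} (hw : U (x, y) = w) (u v : E₁ × E₂) :
    ricciBar (warpedMetric gB gF f) (liftFromBase I₂ P) (x, y) u v =
      a (x, y) * (chartMetric gB x (extChartAt I₁ x x) u.1 v.1 +
        f x ^ 2 * chartMetric gF y (extChartAt I₂ y y) u.2 v.2) +
      b (x, y) * ((chartMetric gB x (extChartAt I₁ x x) u.1 w.1 +
          f x ^ 2 * chartMetric gF y (extChartAt I₂ y y) u.2 w.2) *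
        (chartMetric gB x (extChartAt I₁ x x) v.1 w.1 +
          f x ^ 2 * chartMetric gF y (extChartAt I₂ y y) v.2 w.2)) := by
  rw [← warpedMetric_eq_chartMetric, ← warpedMetric_eq_chartMetric, ← warpedMetric_eq_chartMetric,
    ← hw]
  exact h.ricci_eq (x, y) u v

end Product

/-! ### Metrics and connections that agree near a point -/

section Congr

variable {E : Type*} [NormedAddCommGroup E] [NormedSpace ℝ E]
  {G G' : E → E →L[ℝ] E →L[ℝ] ℝ} {Q Q' : E → E} {z₀ : E}

theorem IsMetricNear.congr (hG : IsMetricNear G z₀) (h : G' =ᶠ[𝓝 z₀] G) : IsMetricNear G' z₀ := by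
  refine ⟨hG.contDiffAt.congr_of_eventuallyEq h, ?_, ?_⟩
  · filter_upwards [h, hG.symm] with z hz hs
    rwa [hz]
  · filter_upwards [h, hG.pos] with z hz hs
    rwa [hz]

theorem christoffelL_congr (h : G' =ᶠ[𝓝 z₀] G) : christoffelL G' =ᶠ[𝓝 z₀] christoffelL G := by
  filter_upwards [h, h.fderiv (𝕜 := ℝ)] with z h1 h2
  rw [christoffelL, christoffelL, h1, h2]

/-- Ricci at a point depends only on the germ of the metric, so the warped formulas, valid near the
point, transfer. -/
theorem localRicci_congr (h : G' =ᶠ[𝓝 z₀] G) (u v : E) :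
    localRicci G' z₀ u v = localRicci G z₀ u v := by
  have hc := christoffelL_congr h
  rw [localRicci, localRicci]
  congr 1
  ext e
  change localRiem G' z₀ u e v = localRiem G z₀ u e v
  simp only [localRiem, ← christoffelL_apply, hc.fderiv_eq, hc.eq_of_nhds]

theorem localNablaL_congr (h : G' =ᶠ[𝓝 z₀] G) (hQ : Q' =ᶠ[𝓝 z₀] Q) :
    localNablaL G' Q' z₀ = localNablaL G Q z₀ := by
  rw [localNablaL, localNablaL, (christoffelL_congr h).eq_of_nhds, hQ.fderiv_eq, hQ.eq_of_nhds]

end Congr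

/-! ### Derivative of a lifted field; trace of the quasi-Einstein identity -/

section

variable {E₁ : Type*} [NormedAddCommGroup E₁] [NormedSpace ℝ E₁] [FiniteDimensional ℝ E₁]
  {E₂ : Type*} [NormedAddCommGroup E₂] [NormedSpace ℝ E₂] [FiniteDimensional ℝ E₂]

theorem localNablaL_localWarped {G₁ : E₁ → E₁ →L[ℝ] E₁ →L[ℝ] ℝ}
    {G₂ : E₂ → E₂ →L[ℝ] E₂ →L[ℝ] ℝ} {φ : E₁ → ℝ} {z₁ : E₁} {z₂ : E₂} (h₁ : IsMetricNear G₁ z₁)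
    (h₂ : IsMetricNear G₂ z₂) (hφ : ContDiffAt ℝ 2 φ z₁) (hpos : 0 < φ z₁) {Q : E₁ → E₁}
    (hQ : DifferentiableAt ℝ Q z₁) (u : E₁ × E₂) :
    localNablaL (localWarped G₁ G₂ φ) (fun z => (Q z.1, (0 : E₂))) (z₁, z₂) u =
      (localNablaL G₁ Q z₁ u.1, (fderiv ℝ φ z₁ (Q z₁) / φ z₁) • u.2) := by
  have hz : ∀ a : E₂, christoffel G₂ z₂ a 0 = 0 := fun a => by simp [← christoffelL_apply]
  have hp : HasFDerivAt (fun z : E₁ × E₂ => Q z.1)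
      ((fderiv ℝ Q z₁).comp (ContinuousLinearMap.fst ℝ E₁ E₂)) (z₁, z₂) :=
    HasFDerivAt.comp (g := Q) (z₁, z₂) hQ.hasFDerivAt hasFDerivAt_fst
  have hq : HasFDerivAt (fun z : E₁ × E₂ => (Q z.1, (0 : E₂))) _ (z₁, z₂) :=
    hp.prodMk (hasFDerivAt_const (0 : E₂) (z₁, z₂))
  rw [localNablaL_apply, localNablaL_apply, localNabla, localNabla, hq.fderiv,
    christoffel_localWarped h₁ h₂ hφ hpos]
  simp [hz]

/-- The `b`-trace of `a b + c b(·, U) ⊗ b(·, U)`. -/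
theorem sum_add_mul_of_isOrthonormalFor {V : Type*} [AddCommGroup V] [Module ℝ V]
    [TopologicalSpace V] (b : V →L[ℝ] V →L[ℝ] ℝ) (hsymm : ∀ u v, b u v = b v u)
    {ι : Type*} [Fintype ι] (e : Module.Basis ι ℝ V) (he : IsOrthonormalFor b e)
    (U : V) (a c : ℝ) :
    ∑ i, (a * b (e i) (e i) + c * (b (e i) U * b (e i) U)) =
      Module.finrank ℝ V * a + c * b U U := by
  rw [← sum_form_mul_of_isOrthonormalFor b e he U U, Finset.sum_add_distrib, Finset.mul_sum,
    Module.finrank_eq_card_basis e]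
  congr 1
  · simp [he.1]
  · exact Finset.sum_congr rfl fun i _ => by rw [hsymm U]

theorem scalarBar_of_isQuasiEinstein
    {H : Type*} [TopologicalSpace H] {I : ModelWithCorners ℝ E₁ H}
    {M : Type*} [TopologicalSpace M] [ChartedSpace H M]
    {g : (p : M) → TangentSpace I p →L[ℝ] TangentSpace I p →L[ℝ] ℝ}
    (hsymm : ∀ p u v, g p u v = g p v u) (hpos : ∀ p v, v ≠ 0 → 0 < g p v v)
    {Q : (p : M) → TangentSpace I p} {a b : M → ℝ} {U : (p : M) → TangentSpace I p}
    (h : IsQuasiEinstein g Q a b U) (p : M) :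
    scalarBar g Q p = Module.finrank ℝ E₁ * a p + b p := by
  let G : E₁ →L[ℝ] E₁ →L[ℝ] ℝ := g p
  let V : E₁ := U p
  obtain ⟨e, he⟩ := exists_isOrthonormalFor G (hsymm p) (hpos p)
  let T : E₁ →ₗ[ℝ] E₁ →ₗ[ℝ] ℝ := a p • ContinuousLinearMap.toLinearMap₁₂ G +
    b p • (G.flip V : E₁ →ₗ[ℝ] ℝ).smulRight (G.flip V : E₁ →ₗ[ℝ] ℝ)
  have hR : scalarBar g Q p = orthoSum G fun u v => T u v :=
    congrArg (orthoSum G) (funext fun u => funext fun v => h.ricci_eq p u v)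
  rw [hR, orthoSum_eq G T e he]
  refine (sum_add_mul_of_isOrthonormalFor G (hsymm p) e he V (a p) (b p)).trans ?_
  rw [show G V V = 1 from h.unit p, mul_one]

end

/-! ### Warped products of manifolds -/

section Warped

variable {E₁ : Type*} [NormedAddCommGroup E₁] [NormedSpace ℝ E₁] [FiniteDimensional ℝ E₁]
  {H₁ : Type*} [TopologicalSpace H₁] {I₁ : ModelWithCorners ℝ E₁ H₁} [I₁.Boundaryless]
  {B : Type*} [TopologicalSpace B] [ChartedSpace H₁ B] [IsManifold I₁ ∞ B]
  {E₂ : Type*} [NormedAddCommGroup E₂] [NormedSpace ℝ E₂] [FiniteDimensional ℝ E₂]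
  {H₂ : Type*} [TopologicalSpace H₂] {I₂ : ModelWithCorners ℝ E₂ H₂} [I₂.Boundaryless]
  {F : Type*} [TopologicalSpace F] [ChartedSpace H₂ F] [IsManifold I₂ ∞ F]
  (gB : ContMDiffRiemannianMetric I₁ ∞ E₁ (fun x : B => TangentSpace I₁ x))
  (gF : ContMDiffRiemannianMetric I₂ ∞ E₂ (fun y : F => TangentSpace I₂ y))
  {f : B → ℝ} {P : (x : B) → TangentSpace I₁ x}

theorem isMetricNear_localWarped_chartMetric (hf : ContMDiff I₁ 𝓘(ℝ, ℝ) ∞ f)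
    (hfpos : ∀ x, 0 < f x) (x : B) (y : F) :
    IsMetricNear (localWarped (chartMetric gB.inner x) (chartMetric gF.inner y)
      (f ∘ (extChartAt I₁ x).symm)) (extChartAt I₁ x x, extChartAt I₂ y y) :=
  (isMetricNear_chartMetric gB x).localWarped (isMetricNear_chartMetric gF y)
    (contDiffAt_comp_extChartAt_symm hf x) (hfpos _)

/-- The Ricci tensor of the semi-symmetric non-metric connection of a warped product. -/
theorem ricciBar_warpedMetric (hf : ContMDiff I₁ 𝓘(ℝ, ℝ) ∞ f) (hfpos : ∀ x, 0 < f x)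
    (hP : ContMDiff I₁ I₁.tangent ∞ (fun x => (⟨x, P x⟩ : TangentBundle I₁ B)))
    (x : B) (y : F) (u v : E₁ × E₂) :
    ricciBar (warpedMetric gB.inner gF.inner f) (liftFromBase I₂ P) (x, y) u v =
      localRicci (localWarped (chartMetric gB.inner x) (chartMetric gF.inner y)
        (f ∘ (extChartAt I₁ x).symm)) (extChartAt I₁ x x, extChartAt I₂ y y) u v +
      ((Module.finrank ℝ E₁ : ℝ) + Module.finrank ℝ E₂ - 1) *
      (chartMetric gB.inner x (extChartAt I₁ x x) v.1 (localNablaL (chartMetric gB.inner x)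
            (chartField P x) (extChartAt I₁ x x) u.1) +
          f x * dirDeriv f x (P x) * chartMetric gF.inner y (extChartAt I₂ y y) v.2 u.2 -
        chartMetric gB.inner x (extChartAt I₁ x x) u.1 (chartField P x (extChartAt I₁ x x)) *
          chartMetric gB.inner x (extChartAt I₁ x x) v.1
            (chartField P x (extChartAt I₁ x x))) := by
  have hW := isMetricNear_localWarped_chartMetric gB gF hf hfpos x y
  have hG := chartMetric_warpedMetric_eventuallyEq gB.inner gF.inner f x y
  have hL := chartField_liftFromBase_eventuallyEq (I₂ := I₂) P x y
  have hQ := differentiableAt_chartField hP x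
  have hG' : IsMetricNear (chartMetric (warpedMetric gB.inner gF.inner f) (x, y))
      (extChartAt (I₁.prod I₂) (x, y) (x, y)) := by
    rw [extChartAt_prod_self]; exact hW.congr hG
  have hQ' : DifferentiableAt ℝ (chartField (liftFromBase I₂ P) (x, y))
      (extChartAt (I₁.prod I₂) (x, y) (x, y)) := by
    rw [extChartAt_prod_self]
    refine DifferentiableAt.congr_of_eventuallyEq ?_ hL
    exact (DifferentiableAt.comp (g := chartField P x) (_ : E₁ × E₂) hQ
      differentiableAt_fst).prodMk (differentiableAt_const _)
  have hne := (hfpos x).ne'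
  have hx : (f ∘ (extChartAt I₁ x).symm) (extChartAt I₁ x x) = f x := by
    rw [Function.comp_apply, extChartAt_to_inv]
  have hd : fderiv ℝ (f ∘ (extChartAt I₁ x).symm) (extChartAt I₁ x x)
      (chartField P x (extChartAt I₁ x x)) = dirDeriv f x (P x) := by
    rw [fderiv_comp_extChartAt_symm (hf.contMDiffAt.mdifferentiableAt (by simp)), chartField_self]
    rfl
  rw [ricciBar_eq hG' hQ', extChartAt_prod_self, localRicci_congr hG, localNablaL_congr hG hL,
    hG.eq_of_nhds, hL.eq_of_nhds,
    localNablaL_localWarped (isMetricNear_chartMetric gB x) (isMetricNear_chartMetric gF y)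
      (contDiffAt_comp_extChartAt_symm hf x) (hfpos _) hQ, Module.finrank_prod, hd]
  simp only [localWarped_apply, hx, map_zero, map_smul, smul_eq_mul, mul_zero, add_zero,
    Nat.cast_add]
  congr 3
  -- On the fibre components f² · (Pf / f) = f · Pf.
  field_simp

/-! ### Quasi-Einstein warped products -/

variable {gB gF}

variable {a b : B × F → ℝ} {U : (p : B × F) → TangentSpace (I₁.prod I₂) p}

theorem warpedMetric_symm (p : B × F) (u v : TangentSpace (I₁.prod I₂) p) :
    warpedMetric gB.inner gF.inner f p u v = warpedMetric gB.inner gF.inner f p v u := by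
  refine (warpedMetric_eq_chartMetric gB.inner gF.inner f p.1 p.2 u v).trans
    (Eq.trans ?_
      (warpedMetric_eq_chartMetric gB.inner gF.inner f p.1 p.2 v u).symm)
  rw [(isMetricNear_chartMetric gB p.1).symm.self_of_nhds u.1 v.1,
    (isMetricNear_chartMetric gF p.2).symm.self_of_nhds u.2 v.2]

theorem warpedMetric_pos (hf : ContMDiff I₁ 𝓘(ℝ, ℝ) ∞ f) (hfpos : ∀ x, 0 < f x) (p : B × F)
    (v : TangentSpace (I₁.prod I₂) p) (hv : v ≠ 0) :
    0 < warpedMetric gB.inner gF.inner f p v v := by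
  have h : ∀ w : E₁ × E₂, w ≠ 0 → 0 < chartMetric gB.inner p.1 (extChartAt I₁ p.1 p.1) w.1 w.1 +
      f p.1 ^ 2 * chartMetric gF.inner p.2 (extChartAt I₂ p.2 p.2) w.2 w.2 := fun w hw => by
    have h := (isMetricNear_localWarped_chartMetric gB gF hf hfpos p.1 p.2).pos.self_of_nhds w hw
    rwa [localWarped_apply, Function.comp_apply, extChartAt_to_inv] at h
  exact (h v hv).trans_eq (warpedMetric_eq_chartMetric gB.inner gF.inner f p.1 p.2 v v).symm

/-- The base trace for arbitrary U; only the last term, with w.1 the base component of U, depends on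
its direction. -/
theorem scalarBar_base_of_isQuasiEinstein
    (hf : ContMDiff I₁ 𝓘(ℝ, ℝ) ∞ f) (hfpos : ∀ x, 0 < f x)
    (hP : ContMDiff I₁ I₁.tangent ∞ (fun x => (⟨x, P x⟩ : TangentBundle I₁ B)))
    (h : IsQuasiEinstein (warpedMetric gB.inner gF.inner f) (liftFromBase I₂ P) a b U)
    (x : B) (y : F) {w : E₁ × E₂} (hw : U (x, y) = w) :
    scalarBar gB.inner P x = Module.finrank ℝ E₁ * a (x, y)
      + Module.finrank ℝ E₂ * (laplacian gB.inner f x / f x)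
      - Module.finrank ℝ E₂ * divergence gB.inner P x
      + Module.finrank ℝ E₂ * gB.inner x (P x) (P x)
      + b (x, y) * chartMetric gB.inner x (extChartAt I₁ x x) w.1 w.1 := by
  have h₁ := isMetricNear_chartMetric gB x
  have h₂ := isMetricNear_chartMetric gF y
  have hφ := contDiffAt_comp_extChartAt_symm hf x
  have hx : (f ∘ (extChartAt I₁ x).symm) (extChartAt I₁ x x) = f x := by
    rw [Function.comp_apply, extChartAt_to_inv]
  have hp : gB.inner x (P x) (P x) = chartMetric gB.inner x (extChartAt I₁ x x)
      (chartField P x (extChartAt I₁ x x)) (chartField P x (extChartAt I₁ x x)) := by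
    rw [chartMetric_self, chartField_self]
    rfl
  obtain ⟨e, he⟩ := h₁.exists_isOrthonormalFor
  have key : ∀ i, localRicci (chartMetric gB.inner x) (extChartAt I₁ x x) (e i) (e i) =
      (a (x, y) * chartMetric gB.inner x (extChartAt I₁ x x) (e i) (e i) +
      b (x, y) * (chartMetric gB.inner x (extChartAt I₁ x x) (e i) w.1 *
        chartMetric gB.inner x (extChartAt I₁ x x) (e i) w.1)) -
      Module.finrank ℝ E₂ / f x * chartMetric gB.inner x (extChartAt I₁ x x)
        (localNablaL (chartMetric gB.inner x) (localGrad (chartMetric gB.inner x)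
          (f ∘ (extChartAt I₁ x).symm)) (extChartAt I₁ x x) (e i)) (e i) -
      ((Module.finrank ℝ E₁ : ℝ) + Module.finrank ℝ E₂ - 1) *
        (chartMetric gB.inner x (extChartAt I₁ x x) (localNablaL (chartMetric gB.inner x)
            (chartField P x) (extChartAt I₁ x x) (e i)) (e i) -
          chartMetric gB.inner x (extChartAt I₁ x x) (chartField P x (extChartAt I₁ x x)) (e i) *
          chartMetric gB.inner x (extChartAt I₁ x x) (e i)
            (chartField P x (extChartAt I₁ x x))) := fun i => by
    -- Solve the diagonal identity on base vectors for the Riemannian Ricci tensor of B.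
    have hr := h.ricciBar_warpedMetric x y hw (e i, 0) (e i, 0)
    rw [WarpedQE.ricciBar_warpedMetric gB gF hf hfpos hP,
      localRicci_localWarped_base h₁ h₂ hφ (hfpos _), hx,
      ← h₁.apply_localNablaL_localGrad hφ] at hr
    simp only [map_zero, zero_apply, mul_zero, add_zero] at hr
    rw [h₁.symm.self_of_nhds (e i) (localNablaL _ (chartField P x) _ _)] at hr
    rw [h₁.symm.self_of_nhds (chartField P x (extChartAt I₁ x x)) (e i)]
    linear_combination hr
  rw [scalarBar_eq h₁ (differentiableAt_chartField hP x) e he,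
    Finset.sum_congr rfl fun i _ => key i,
    Finset.sum_sub_distrib, Finset.sum_sub_distrib,
    sum_add_mul_of_isOrthonormalFor _ h₁.symm.self_of_nhds e he, ← Finset.mul_sum,
    ← Finset.mul_sum, Finset.sum_sub_distrib, sum_form_eq_trace _ e he, sum_form_eq_trace _ e he,
    sum_form_mul_of_isOrthonormalFor _ e he, laplacian_eq h₁ hf, divergence_eq h₁, hp]
  ring

/-- The fibre trace for arbitrary U. Each factor g(·, U) on fibre vectors carries f², whence f⁴. The
fibre connection is Levi-Civita, so P enters only through Pf. -/
theorem scalarBar_fibre_of_isQuasiEinstein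
    (hf : ContMDiff I₁ 𝓘(ℝ, ℝ) ∞ f) (hfpos : ∀ x, 0 < f x)
    (hP : ContMDiff I₁ I₁.tangent ∞ (fun x => (⟨x, P x⟩ : TangentBundle I₁ B)))
    (h : IsQuasiEinstein (warpedMetric gB.inner gF.inner f) (liftFromBase I₂ P) a b U)
    (x : B) (y : F) {w : E₁ × E₂} (hw : U (x, y) = w) :
    scalarBar gF.inner (fun _ => 0) y = Module.finrank ℝ E₂ * (f x * laplacian gB.inner f x
      + (1 - Module.finrank ℝ E₂) *
        gB.inner x (gradVec gB.inner f x) (gradVec gB.inner f x)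
      + (1 - ((Module.finrank ℝ E₁ : ℝ) + Module.finrank ℝ E₂)) * f x * dirDeriv f x (P x)
      + a (x, y) * f x ^ 2)
      + b (x, y) * f x ^ 4 *
        chartMetric gF.inner y (extChartAt I₂ y y) w.2 w.2 := by
  have h₁ := isMetricNear_chartMetric gB x
  have h₂ := isMetricNear_chartMetric gF y
  have hφ := contDiffAt_comp_extChartAt_symm hf x
  have hx : (f ∘ (extChartAt I₁ x).symm) (extChartAt I₁ x x) = f x := by
    rw [Function.comp_apply, extChartAt_to_inv]
  have hz : chartField (fun y : F => (0 : TangentSpace I₂ y)) y = fun _ => (0 : E₂) :=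
    funext fun z => map_zero (mfderiv 𝓘(ℝ, E₂) I₂ (extChartAt I₂ y).symm z).inverse
  have hg : gB.inner x (gradVec gB.inner f x) (gradVec gB.inner f x) =
      chartMetric gB.inner x (extChartAt I₁ x x)
        (localGrad (chartMetric gB.inner x) (f ∘ (extChartAt I₁ x).symm) (extChartAt I₁ x x))
        (localGrad (chartMetric gB.inner x) (f ∘ (extChartAt I₁ x).symm)
          (extChartAt I₁ x x)) := by
    rw [gradVec_eq hf, chartMetric_self]
    rfl
  obtain ⟨e, he⟩ := h₂.exists_isOrthonormalFor
  have key : ∀ i, localRicci (chartMetric gF.inner y) (extChartAt I₂ y y) (e i) (e i) =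
      (a (x, y) * f x ^ 2 + f x * laplacian gB.inner f x
        + (1 - Module.finrank ℝ E₂) *
          gB.inner x (gradVec gB.inner f x) (gradVec gB.inner f x)
        + (1 - ((Module.finrank ℝ E₁ : ℝ) + Module.finrank ℝ E₂)) * f x * dirDeriv f x (P x)) *
          chartMetric gF.inner y (extChartAt I₂ y y) (e i) (e i) +
      b (x, y) * f x ^ 4 *
        (chartMetric gF.inner y (extChartAt I₂ y y) (e i) w.2 *
        chartMetric gF.inner y (extChartAt I₂ y y) (e i) w.2) := fun i => by
    have hr := h.ricciBar_warpedMetric x y hw (0, e i) (0, e i)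
    rw [WarpedQE.ricciBar_warpedMetric gB gF hf hfpos hP,
      localRicci_localWarped_fibre h₁ h₂ hφ (hfpos _), hx] at hr
    rw [laplacian_eq h₁ hf, hg]
    simp only [map_zero, zero_apply, mul_zero, zero_add, sub_zero] at hr
    linear_combination hr
  rw [scalarBar_eq h₂ (by rw [hz]; exact differentiableAt_const _) e he,
    Finset.sum_congr rfl fun i _ => key i,
    sum_add_mul_of_isOrthonormalFor _ h₂.symm.self_of_nhds e he]
  have ht : localNablaL (chartMetric gF.inner y)
      (chartField (fun y : F => (0 : TangentSpace I₂ y)) y) (extChartAt I₂ y y) = 0 := by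
    ext v
    simp [hz, localNablaL]
  rw [ht, hz, hg]
  simp only [map_zero]
  ring

end Warped

end

end WarpedQE

/-! ### The two cases of U tangent to a factor -/

theorem proposition3p3 {n₁ n₂ : ℕ}
    {B : Type*} [TopologicalSpace B] [ChartedSpace (EuclideanSpace ℝ (Fin n₁)) B]
    [IsManifold (𝓡 n₁) ∞ B]
    {F : Type*} [TopologicalSpace F] [ChartedSpace (EuclideanSpace ℝ (Fin n₂)) F]
    [IsManifold (𝓡 n₂) ∞ F]
    (gB : ContMDiffRiemannianMetric (𝓡 n₁) ∞ (EuclideanSpace ℝ (Fin n₁))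
      (fun x : B => TangentSpace (𝓡 n₁) x))
    (gF : ContMDiffRiemannianMetric (𝓡 n₂) ∞ (EuclideanSpace ℝ (Fin n₂))
      (fun y : F => TangentSpace (𝓡 n₂) y))
    (f : B → ℝ) (hf : ContMDiff (𝓡 n₁) 𝓘(ℝ, ℝ) ∞ f) (hfpos : ∀ x, 0 < f x)
    (P : (x : B) → TangentSpace (𝓡 n₁) x)
    (hP : ContMDiff (𝓡 n₁) (𝓡 n₁).tangent ∞
      (fun x => (⟨x, P x⟩ : TangentBundle (𝓡 n₁) B)))
    (a b : B × F → ℝ)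
    (U : (p : B × F) → TangentSpace ((𝓡 n₁).prod (𝓡 n₂)) p)
    (hQE : IsQuasiEinstein (warpedMetric gB.inner gF.inner f) (liftFromBase (𝓡 n₂) P) a b U) :
    (TangentToBase U → ∀ (x : B) (y : F),
      scalarBar (warpedMetric gB.inner gF.inner f) (liftFromBase (𝓡 n₂) P) (x, y)
          = ((n₁ : ℝ) + n₂) * a (x, y) + b (x, y) ∧
      scalarBar gB.inner P x
          = n₁ * a (x, y) + n₂ * (laplacian gB.inner f x / f x)
            - n₂ * divergence gB.inner P x + n₂ * gB.inner x (P x) (P x) + b (x, y) ∧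
      scalarBar gF.inner (fun _ => 0) y
          = n₂ * (f x * laplacian gB.inner f x
            + (1 - n₂) * gB.inner x (gradVec gB.inner f x) (gradVec gB.inner f x)
            + (1 - ((n₁ : ℝ) + n₂)) * f x * dirDeriv f x (P x)
            + a (x, y) * f x ^ 2)) ∧
    (TangentToFibre U → ∀ (x : B) (y : F),
      scalarBar (warpedMetric gB.inner gF.inner f) (liftFromBase (𝓡 n₂) P) (x, y)
          = ((n₁ : ℝ) + n₂) * a (x, y) + b (x, y) ∧
      scalarBar gB.inner P x
          = n₁ * a (x, y) + n₂ * (laplacian gB.inner f x / f x)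
            - n₂ * divergence gB.inner P x + n₂ * gB.inner x (P x) (P x) ∧
      scalarBar gF.inner (fun _ => 0) y
          = n₂ * (f x * laplacian gB.inner f x
            + (1 - n₂) * gB.inner x (gradVec gB.inner f x) (gradVec gB.inner f x)
            + (1 - ((n₁ : ℝ) + n₂)) * f x * dirDeriv f x (P x)
            + a (x, y) * f x ^ 2)
            + b (x, y) * f x ^ 2) := by
  -- Gives U p the product type, so that its two components can be named.
  have hU : ∀ p, ∃ w : EuclideanSpace ℝ (Fin n₁) × EuclideanSpace ℝ (Fin n₂), U p = w :=
    fun p => ⟨U p, rfl⟩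
  have hB := fun x => isMetricNear_chartMetric gB x
  have hF := fun y => isMetricNear_chartMetric gF y
  have hM : ∀ x y, scalarBar (warpedMetric gB.inner gF.inner f) (liftFromBase (𝓡 n₂) P) (x, y) =
      ((n₁ : ℝ) + n₂) * a (x, y) + b (x, y) := fun x y => by
    have hdim : ((n₁ : ℝ) + n₂) =
        Module.finrank ℝ (EuclideanSpace ℝ (Fin n₁) × EuclideanSpace ℝ (Fin n₂)) := by
      rw [Module.finrank_prod, finrank_euclideanSpace_fin, finrank_euclideanSpace_fin,
        Nat.cast_add]
    rw [hdim]
    refine scalarBar_of_isQuasiEinstein (fun p u v => ?_) (fun p v hv => ?_) hQE (x, y)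
    · exact warpedMetric_symm p u v
    · exact warpedMetric_pos hf hfpos p v hv
  have hunit : ∀ (x : B) (y : F) (w : EuclideanSpace ℝ (Fin n₁) × EuclideanSpace ℝ (Fin n₂)),
      U (x, y) = w → chartMetric gB.inner x (extChartAt (𝓡 n₁) x x) w.1 w.1 +
        f x ^ 2 * chartMetric gF.inner y (extChartAt (𝓡 n₂) y y) w.2 w.2 = 1 := by
    rintro x y w rfl
    exact (warpedMetric_eq_chartMetric gB.inner gF.inner f x y _ _).symm.trans (hQE.unit (x, y))
  refine ⟨fun hT x y => ⟨hM x y, ?_, ?_⟩, fun hT x y => ⟨hM x y, ?_, ?_⟩⟩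
  all_goals
    obtain ⟨w, hw⟩ := hU (x, y)
    have hu := hunit x y w hw
    have hb := scalarBar_base_of_isQuasiEinstein hf hfpos hP hQE x y hw
    have hf' := scalarBar_fibre_of_isQuasiEinstein hf hfpos hP hQE x y hw
    simp only [finrank_euclideanSpace_fin] at hb hf'
    have ht := hT (x, y)
    first | rw [mfderiv_fst] at ht | rw [mfderiv_snd] at ht
    rw [hw] at ht
  · have h2 : w.2 = 0 := ht
    simp only [h2, map_zero, mul_zero, add_zero] at hu
    rw [hb, hu, mul_one]
  · have h2 : w.2 = 0 := ht
    rw [hf', h2, map_zero, mul_zero, add_zero]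
  · have h1 : w.1 = 0 := ht
    rw [hb, h1, map_zero, mul_zero, add_zero]
  · have h1 : w.1 = 0 := ht
    simp only [h1, map_zero, zero_add] at hu
    rw [hf']
    -- Here f² g_F(w.2, w.2) = 1, which turns the b f⁴ term into b f².
    linear_combination b (x, y) * f x ^ 2 * hu
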